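/- For $x \in \mathbb{Z}^n$ let $|a_1| \ge |a_2| \ge \dots \ge |a_n|$ be the absolute values of the coordinates of $x$ in non-increasing order, and for $0 \le k \le n$ let $\|x_{-k}\|_2^2 = \sum_{i=k+1}^{n} a_i^2$. Put $|0|^0 = 0$, so that for $p = 0$ sums of $|a_i|^p$ count nonzero coordinates. A linear sketch for vectors in $\mathbb{Z}^n$ consists of a string of uniformly random bits, an integer matrix $S$ with $n$ columns determined by this string, and a decoding function that computes a real estimate from the string and $Sx$ alone. Its space on inputs with coordinates in $[-m,m]$ is the length of the random string plus the number of bits of signed counters large enough to hold all entries of $Sx$ for every such $x$. **Theorem.** For every constant $c \in \mathbb{R}$ there is an exponent $E$ such that for every $\delta > 0$ and every $d \in \mathbb{N}$ there is a constant $C$ with the following property. Let $n \ge 2$, $0 \le k \le n/2$, $\varepsilon \in (0,1)$ and $0 \le p \le 2$. Then there is a linear sketch for vectors in $\mathbb{Z}^n$, using at most $C(\log n/\varepsilon)^E$ bits of space on inputs with coordinates in $[-n^d, n^d]$, such that for every $x \in \mathbb{Z}^n$ with $\max_i |x_i| \le n^d$ that satisfies, if $k \ge 1$, $$a_k^2 \ge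 \left(\frac{\varepsilon}{\log n}\right)^{c} \cdot \frac{\|x_{-k}\|_2^2}{k},$$ the sketch outputs, with probability at least $1 - \delta$, an estimate of $\sum_{i=k}^{n-k} |a_i|^p$ with additive error at most $$\varepsilon \left( \sum_{i=k}^{n-k} |a_i|^p + k\,\bigl|a_{\lceil k - \varepsilon k \rceil}\bigr|^p \right).$$ For $k = 0$ the sums start at $i = 1$ and the term with the factor $k$ is absent. -/

import Mathlib

/-- The absolute values of the coordinates of `x`, in non-increasing order. -/
def sortedAbs {n : ℕ} (x : Fin n → ℤ) : List ℕ :=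
  (List.ofFn fun j => (x j).natAbs).insertionSort (fun s t => t ≤ s)

/-- `topAbs x i` is `|a_i|`, the `i`-th largest absolute value of a coordinate of `x`, where the
ranks run through `1, …, n` (outside this range the value plays no role). -/
def topAbs {n : ℕ} (x : Fin n → ℤ) (i : ℕ) : ℕ :=
  (sortedAbs x).getD (i - 1) 0

/-- `|t|^p` with the frequency-moment convention `0^0 = 0`, so that the moment for `p = 0` counts
the nonzero coordinates. -/
noncomputable def freqPow (p : ℝ) (t : ℕ) : ℝ :=
  if t = 0 then 0 else (t : ℝ) ^ p

/-- The squared Euclidean norm of `x` without its `k` coordinates of largest absolute value. -/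
def tailSq {n : ℕ} (x : Fin n → ℤ) (k : ℕ) : ℕ :=
  ∑ i ∈ Finset.Icc (k + 1) n, topAbs x i ^ 2

/-- The `k`-trimmed moment: the sum of `|a_i|^p` over the ranks `i` with `k ≤ i ≤ n - k`
(ranks start at `1`). -/
noncomputable def trimmedMoment {n : ℕ} (x : Fin n → ℤ) (k : ℕ) (p : ℝ) : ℝ :=
  ∑ i ∈ Finset.Icc (max 1 k) (n - k), freqPow p (topAbs x i)

/-- A randomized linear sketch of `n`-dimensional integer vectors. A uniformly random string of
`seedBits` bits determines an integer matrix `S` with `rows` rows; the sketch stores this string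
and the vector `S x`, and an estimate is computed from these two alone. -/
structure LinearSketch (n : ℕ) where
  seedBits : ℕ
  rows : ℕ
  matrix : (Fin seedBits → Bool) → Matrix (Fin rows) (Fin n) ℤ
  decode : (Fin seedBits → Bool) → (Fin rows → ℤ) → ℝ

namespace LinearSketch

/-- The output of the sketch on the input `x`, for the random string `ω`. -/
def estimate {n : ℕ} (A : LinearSketch n) (ω : Fin A.seedBits → Bool) (x : Fin n → ℤ) : ℝ :=
  A.decode ω ((A.matrix ω).mulVec x)

/-- On all vectors with coordinates in `[-m, m]` the sketch fits into `B` bits: the random string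
is stored, and each entry of `S x` is stored in a signed counter with `w` binary digits and a sign
bit that never overflows. -/
def UsesAtMostBits {n : ℕ} (A : LinearSketch n) (m : ℕ) (B : ℝ) : Prop :=
  ∃ w : ℕ,
    (∀ (ω : Fin A.seedBits → Bool) (x : Fin n → ℤ), (∀ i, |x i| ≤ (m : ℤ)) →
      ∀ j, |(A.matrix ω).mulVec x j| < 2 ^ w) ∧
    ((A.seedBits + A.rows * (w + 1) : ℕ) : ℝ) ≤ B

open Classical in
/-- The probability, over the uniformly random string, that on the input `x` the sketch outputs
a value at distance at most `err` from `v`. -/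
noncomputable def probWithin {n : ℕ} (A : LinearSketch n) (x : Fin n → ℤ) (v err : ℝ) : ℝ :=
  ((Finset.univ.filter fun ω : Fin A.seedBits → Bool => |A.estimate ω x - v| ≤ err).card : ℝ) /
    (2 : ℝ) ^ A.seedBits

end LinearSketch

/-! Up to a small relative error in the thresholds, the trimmed moment is determined by the counting
functions `countGe x v`, and these can be read off sparse random sign rows. Let each coordinate
survive in a row with probability `q`, and suppose `q * cappedMass x v` is about a small `κ`. Two
coordinates above `τ * v` rarely survive together, and by an exponential moment bound the smaller
ones rarely add up to `a * v`. So an entry reaches `v` with probability close to `q * countGe x v`,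
apart from a slight blur of the threshold (`rowProb_bounds`). Among the rates `2 ^ (-j)` one fits
any mass that matters. Hence two vectors with similar row statistics at all rates have similar
counts, with an error `η` times their capped masses (`countGe_le_of_rowProb_le`).

For `p ≤ 2` the quantity `v ^ p * cappedMass x v` is controlled by the trimmed moment and terms of
size `k * |a_k| ^ p` (`rpow_mul_cappedMass_le`). Summed over a geometric grid of thresholds, the
counting errors therefore stay within the permitted error. An error of up to `ε * k` in the counts
is what replaces rank `k` by rank `⌈k - ε * k⌉` (`freqPow_topAbs_le`, `abs_trimmedMoment_sub_le`).

Decoding is exhaustive search: output the trimmed moment of any vector of the box whose expected row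
statistics match the observed frequencies. The input is such a vector as soon as the frequencies
concentrate. Storing independent rows would take too many random bits, so a list of `2 ^ s` choices
of all rows is fixed in advance, few of which fail for any given input (`exists_family_few_bad`).
The seed is only an index into this list. -/

/-! ### Expectations over finite product distributions -/

/-- The expectation of `F` on a finite product, the coordinates being independent and the
`i`-th one having the probability weights `w i`. -/
noncomputable def prodExp {ι α : Type*} [Fintype ι] [DecidableEq ι] [Fintype α]
    (w : ι → α → ℝ) (F : (ι → α) → ℝ) : ℝ :=
  ∑ ω : ι → α, (∏ i, w i (ω i)) * F ω

/-- All `w i` are probability weights. -/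
structure ProbWeights {ι α : Type*} [Fintype α] (w : ι → α → ℝ) : Prop where
  nonneg : ∀ i a, 0 ≤ w i a
  sum_eq : ∀ i, ∑ a, w i a = 1

section prodExp

variable {ι α : Type*} [Fintype ι] [DecidableEq ι] [Fintype α] {w : ι → α → ℝ}

theorem prodExp_prod (w f : ι → α → ℝ) :
    prodExp w (fun ω => ∏ i, f i (ω i)) = ∏ i, ∑ a, w i a * f i a := by
  classical
  unfold prodExp
  rw [Finset.prod_univ_sum, Fintype.piFinset_univ]
  exact Finset.sum_congr rfl fun ω _ => Finset.prod_mul_distrib.symm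

theorem prodExp_add (w : ι → α → ℝ) (F G : (ι → α) → ℝ) :
    prodExp w (fun ω => F ω + G ω) = prodExp w F + prodExp w G := by
  simp [prodExp, mul_add, Finset.sum_add_distrib]

theorem prodExp_const_mul (w : ι → α → ℝ) (c : ℝ) (F : (ι → α) → ℝ) :
    prodExp w (fun ω => c * F ω) = c * prodExp w F := by
  simp only [prodExp, Finset.mul_sum]
  exact Finset.sum_congr rfl fun ω _ => by ring

theorem prodExp_sub (w : ι → α → ℝ) (F G : (ι → α) → ℝ) :
    prodExp w (fun ω => F ω - G ω) = prodExp w F - prodExp w G := by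
  simp [prodExp, mul_sub, Finset.sum_sub_distrib]

theorem prodExp_sum {κ : Type*} (w : ι → α → ℝ) (S : Finset κ) (F : κ → (ι → α) → ℝ) :
    prodExp w (fun ω => ∑ s ∈ S, F s ω) = ∑ s ∈ S, prodExp w (F s) := by
  simp only [prodExp, Finset.mul_sum]
  exact Finset.sum_comm

theorem prodExp_mono (hw : ProbWeights w) {F G : (ι → α) → ℝ} (h : ∀ ω, F ω ≤ G ω) :
    prodExp w F ≤ prodExp w G :=
  Finset.sum_le_sum fun ω _ =>
    mul_le_mul_of_nonneg_left (h ω) (Finset.prod_nonneg fun i _ => hw.nonneg i _)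

theorem prodExp_one (hw : ProbWeights w) : prodExp w (fun _ => 1) = 1 := by
  have := prodExp_prod w (fun _ _ => 1)
  simpa [hw.sum_eq] using this

theorem prodExp_const (hw : ProbWeights w) (c : ℝ) : prodExp w (fun _ => c) = c := by
  have := prodExp_const_mul w c (fun _ => 1)
  simpa [prodExp_one hw] using this

/-- The product of probability weights. -/
theorem ProbWeights.prod {κ : Type*} (w : κ → ι → α → ℝ) (hw : ∀ s, ProbWeights (w s)) :
    ProbWeights (fun (s : κ) (ω : ι → α) => ∏ i, w s i (ω i)) where
  nonneg s ω := Finset.prod_nonneg fun i _ => (hw s).nonneg i _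
  sum_eq s := by simpa [prodExp] using prodExp_one (hw s)

theorem prodExp_single (hw : ProbWeights w) (i : ι) (f : α → ℝ) :
    prodExp w (fun ω => f (ω i)) = ∑ a, w i a * f a := by
  have h := prodExp_prod w (fun l a => if l = i then f a else 1)
  have h1 : ∀ ω : ι → α, ∏ l, (if l = i then f (ω l) else 1) = f (ω i) := fun ω => by
    rw [Finset.prod_ite_eq']; simp
  simp only [h1] at h
  rw [h, ← Finset.mul_prod_erase _ _ (Finset.mem_univ i), Finset.prod_eq_one]
  · simp
  · intro l hl
    simp [Finset.ne_of_mem_erase hl, hw.sum_eq]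

theorem prodExp_pair (hw : ProbWeights w) {i j : ι} (hij : i ≠ j) (f g : α → ℝ) :
    prodExp w (fun ω => f (ω i) * g (ω j)) = (∑ a, w i a * f a) * ∑ a, w j a * g a := by
  have h := prodExp_prod w (fun l a => (if l = i then f a else 1) * (if l = j then g a else 1))
  have h1 : ∀ ω : ι → α, ∏ l, (if l = i then f (ω l) else 1) * (if l = j then g (ω l) else 1)
      = f (ω i) * g (ω j) := fun ω => by
    rw [Finset.prod_mul_distrib, Finset.prod_ite_eq', Finset.prod_ite_eq']; simp
  simp only [h1] at h
  have hj : j ∈ Finset.univ.erase i := Finset.mem_erase.2 ⟨hij.symm, Finset.mem_univ _⟩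
  rw [h, ← Finset.mul_prod_erase _ _ (Finset.mem_univ i), ← Finset.mul_prod_erase _ _ hj,
    Finset.prod_eq_one]
  · simp [hij, hij.symm]
  · intro l hl
    have hl1 := Finset.ne_of_mem_erase hl
    have hl2 := Finset.ne_of_mem_erase (Finset.mem_of_mem_erase hl)
    simp [hl1, hl2, hw.sum_eq]

open Classical in
/-- Markov's inequality. -/
theorem prodExp_markov (hw : ProbWeights w) {F : (ι → α) → ℝ} (hF : ∀ ω, 0 ≤ F ω) {c : ℝ}
    (hc : 0 < c) : prodExp w (fun ω => if c ≤ F ω then 1 else 0) ≤ prodExp w F / c := by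
  rw [le_div_iff₀ hc, mul_comm, ← prodExp_const_mul]
  refine prodExp_mono hw fun ω => ?_
  split_ifs with h
  · simpa using h
  · simpa using hF ω

open Classical in
/-- Chebyshev's inequality for a sum of independent centred variables. -/
theorem prodExp_chebyshev (hw : ProbWeights w) (S : Finset ι) (g : ι → α → ℝ)
    (h0 : ∀ i ∈ S, ∑ a, w i a * g i a = 0) (h1 : ∀ i ∈ S, ∀ a, |g i a| ≤ 1) {c : ℝ}
    (hc : 0 < c) :
    prodExp w (fun ω => if c ≤ |∑ i ∈ S, g i (ω i)| then 1 else 0) ≤ S.card / c ^ 2 := by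
  have hsq : prodExp w (fun ω => (∑ i ∈ S, g i (ω i)) ^ 2) ≤ S.card := by
    have e1 : (fun ω : ι → α => (∑ i ∈ S, g i (ω i)) ^ 2) =
        fun ω => ∑ i ∈ S, ∑ j ∈ S, g i (ω i) * g j (ω j) := by
      funext ω
      rw [sq, Finset.sum_mul_sum]
    rw [e1, prodExp_sum]
    have : ∀ i ∈ S, prodExp w (fun ω => ∑ j ∈ S, g i (ω i) * g j (ω j)) ≤ 1 := by
      intro i hi
      rw [prodExp_sum, Finset.sum_eq_single_of_mem i hi]
      · calc prodExp w (fun ω => g i (ω i) * g i (ω i)) ≤ prodExp w (fun _ => 1) := by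
              refine prodExp_mono hw fun ω => ?_
              have := h1 i hi (ω i)
              rw [← abs_mul_abs_self]
              nlinarith [abs_nonneg (g i (ω i))]
          _ = 1 := prodExp_one hw
      · intro j _ hji
        rw [prodExp_pair hw hji.symm, h0 i hi, zero_mul]
    calc _ ≤ ∑ i ∈ S, (1 : ℝ) := Finset.sum_le_sum this
      _ = S.card := by simp
  calc _ ≤ prodExp w (fun ω => if c ^ 2 ≤ (∑ i ∈ S, g i (ω i)) ^ 2 then 1 else 0) := by
        refine prodExp_mono hw fun ω => ?_
        have : c ^ 2 ≤ (∑ i ∈ S, g i (ω i)) ^ 2 ↔ c ≤ |∑ i ∈ S, g i (ω i)| := by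
          rw [sq_le_sq, abs_of_pos hc]
        simp only [this, le_refl]
    _ ≤ _ := prodExp_markov hw (fun ω => sq_nonneg _) (by positivity)
    _ ≤ _ := by gcongr

end prodExp

/-! ### A fixed list of choices in place of full randomness -/

open Classical in
/-- If every input fails with small probability, then some fixed family of random choices fails
on few of its members, for all inputs simultaneously. -/
theorem exists_family_few_bad {ι Ω X : Type*} [Fintype ι] [Fintype Ω] [Fintype X]
    (w : Ω → ℝ) (hw0 : ∀ a, 0 ≤ w a) (hw1 : ∑ a, w a = 1) (bad : X → Ω → Prop) (c : ℕ)
    (h : ∀ x, ∑ a, w a * (if bad x a then 1 else 0) ≤ 1 / 4 ^ c)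
    (hX : Fintype.card X < 2 ^ Fintype.card ι) :
    ∃ σ : ι → Ω, ∀ x, c * (Finset.univ.filter fun i => bad x (σ i)).card < Fintype.card ι := by
  by_contra hcon
  push Not at hcon
  set m := Fintype.card ι
  have hP : ProbWeights (fun (_ : ι) => w) := ⟨fun _ => hw0, fun _ => hw1⟩
  -- With `b` bad members, `Z x σ = 4 ^ (c * b)`. Each factor has mean at most `1 + 4 ^ c / 4 ^ c =
  -- 2`, so `Z x` has mean at most `2 ^ m`. If every family failed for some input, the sum over
  -- fewer than `2 ^ m` inputs would always be at least `4 ^ m`.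
  let Z : X → (ι → Ω) → ℝ := fun x σ => ∏ i, if bad x (σ i) then (4 : ℝ) ^ c else 1
  have hZ : ∀ x, prodExp (fun _ : ι => w) (Z x) ≤ 2 ^ m := by
    intro x
    rw [prodExp_prod (fun _ : ι => w) (fun _ a => if bad x a then (4 : ℝ) ^ c else 1)]
    rw [Finset.prod_const, Finset.card_univ]
    refine pow_le_pow_left₀ (Finset.sum_nonneg fun a _ => mul_nonneg (hw0 a) ?_) ?_ _
    · split_ifs <;> positivity
    · calc ∑ a, w a * (if bad x a then (4 : ℝ) ^ c else 1)
          ≤ ∑ a, (w a + 4 ^ c * (w a * (if bad x a then 1 else 0))) := by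
            refine Finset.sum_le_sum fun a _ => ?_
            split_ifs
            · linarith [hw0 a, mul_comm (w a) ((4 : ℝ) ^ c)]
            · simp
        _ ≤ 1 + 4 ^ c * (1 / 4 ^ c) := by
            rw [Finset.sum_add_distrib, hw1, ← Finset.mul_sum]
            gcongr
            exact h x
        _ = 2 := by field_simp; norm_num
  have hbig : ∀ σ : ι → Ω, (4 : ℝ) ^ m ≤ ∑ x, Z x σ := by
    intro σ
    obtain ⟨x, hx⟩ := hcon σ
    have hnn : ∀ x ∈ Finset.univ, 0 ≤ Z x σ := fun x _ =>
      Finset.prod_nonneg fun i _ => by split_ifs <;> positivity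
    refine le_trans ?_ (Finset.single_le_sum hnn (Finset.mem_univ x))
    have : Z x σ = 4 ^ (c * (Finset.univ.filter fun i => bad x (σ i)).card) := by
      simp only [Z]
      rw [Finset.prod_ite, Finset.prod_const, Finset.prod_const_one, mul_one, pow_mul]
    rw [this]
    exact pow_le_pow_right₀ (by norm_num) hx
  have h1 := prodExp_mono hP hbig
  rw [prodExp_const hP, prodExp_sum] at h1
  have h2 : ∑ x, prodExp (fun _ : ι => w) (Z x) ≤ ∑ _x : X, (2 : ℝ) ^ m :=
    Finset.sum_le_sum fun x _ => hZ x
  rw [Finset.sum_const, Finset.card_univ, nsmul_eq_mul] at h2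
  have h3 : (Fintype.card X : ℝ) < 2 ^ m := by exact_mod_cast hX
  have h4 : (4 : ℝ) ^ m = 2 ^ m * 2 ^ m := by rw [← mul_pow]; norm_num
  have h5 : (Fintype.card X : ℝ) * 2 ^ m < 2 ^ m * 2 ^ m :=
    mul_lt_mul_of_pos_right h3 (by positivity)
  linarith

/-! ### Entries of a sparse random sign row -/

/-- The law of a random sign that is nonzero with probability `q`. -/
noncomputable def signWeight (q : ℝ) (s : SignType) : ℝ := if s = 0 then 1 - q else q / 2

theorem sum_signType (f : SignType → ℝ) : ∑ s, f s = f 0 + f (-1) + f 1 := by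
  rw [SignType.univ_eq, Finset.sum_insert (by decide), Finset.sum_insert (by decide),
    Finset.sum_singleton, add_assoc]

theorem probWeights_signWeight (ι : Type*) {q : ℝ} (h0 : 0 ≤ q) (h1 : q ≤ 1) :
    ProbWeights (fun (_ : ι) => signWeight q) where
  nonneg _ a := by unfold signWeight; split_ifs <;> linarith
  sum_eq _ := by rw [sum_signType]; simp [signWeight]; ring

section rowVal

variable {ι : Type*} [Fintype ι]

/-- The entry of the sketch produced by a row of signs. -/
def rowVal (ξ : ι → SignType) (x : ι → ℤ) : ℤ := ∑ i, (ξ i : ℤ) * x i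

/-- The number of coordinates of absolute value at least `v`. -/
noncomputable def countGe (x : ι → ℤ) (v : ℝ) : ℕ :=
  (Finset.univ.filter fun i => v ≤ |(x i : ℝ)|).card

/-- The squared norm of `x / v` with all coordinates capped at `1`. -/
noncomputable def cappedMass (x : ι → ℤ) (v : ℝ) : ℝ := ∑ i, min 1 ((x i : ℝ) ^ 2 / v ^ 2)

theorem cappedMass_nonneg (x : ι → ℤ) (v : ℝ) : 0 ≤ cappedMass x v :=
  Finset.sum_nonneg fun _ _ => by positivity

/-- The indicator of a nonzero sign. -/
noncomputable def signInd (s : SignType) : ℝ := if s = 0 then 0 else 1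

theorem signInd_nonneg (s : SignType) : 0 ≤ signInd s := by unfold signInd; split_ifs <;> simp

theorem sum_signWeight_signInd (q : ℝ) : ∑ s, signWeight q s * signInd s = q := by
  rw [sum_signType]; simp [signWeight, signInd]

theorem abs_sign_mul (s : SignType) (y : ℝ) : |((s : ℤ) : ℝ) * y| = signInd s * |y| := by
  cases s <;> simp [signInd]

theorem rowVal_eq_add (ξ : ι → SignType) (x : ι → ℤ) (t : ℝ) :
    (rowVal ξ x : ℝ) =
      ∑ i ∈ Finset.univ.filter (fun i => t ≤ |(x i : ℝ)|), ((ξ i : ℤ) : ℝ) * (x i : ℝ) +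
      ∑ i ∈ Finset.univ.filter (fun i => ¬ t ≤ |(x i : ℝ)|), ((ξ i : ℤ) : ℝ) * (x i : ℝ) := by
  rw [Finset.sum_filter_add_sum_filter_not]
  simp [rowVal]

/-- The cases are no survivor in `S`, exactly one, and a collision. Only the middle case carries
information about an individual coordinate. -/
theorem signInd_cases (ξ : ι → SignType) (S : Finset ι) (y : ι → ℝ) :
    ((∀ i ∈ S, ξ i = 0) ∧ ∑ i ∈ S, signInd (ξ i) = 0 ∧ ∑ i ∈ S, ((ξ i : ℤ) : ℝ) * y i = 0) ∨
    (∃ i ∈ S, ξ i ≠ 0 ∧ (∀ j ∈ S, ξ j ≠ 0 → j = i) ∧ ∑ i ∈ S, signInd (ξ i) = 1 ∧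
      |∑ i ∈ S, ((ξ i : ℤ) : ℝ) * y i| = |y i|) ∨
    2 ≤ ∑ i ∈ S, signInd (ξ i) := by
  classical
  have hm : ∑ i ∈ S, signInd (ξ i) = ((S.filter fun i => ξ i ≠ 0).card : ℝ) := by
    rw [Finset.card_filter]
    push_cast
    exact Finset.sum_congr rfl fun i _ => by by_cases h : ξ i = 0 <;> simp [signInd, h]
  rcases Nat.lt_or_ge (S.filter fun i => ξ i ≠ 0).card 2 with h | h
  · rcases Nat.lt_or_ge (S.filter fun i => ξ i ≠ 0).card 1 with h1 | h1
    · left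
      have h0 : (S.filter fun i => ξ i ≠ 0) = ∅ := by
        rw [← Finset.card_eq_zero]; omega
      have hz : ∀ i ∈ S, ξ i = 0 := fun i hi => by
        by_contra hne
        have : i ∈ S.filter fun i => ξ i ≠ 0 := Finset.mem_filter.2 ⟨hi, hne⟩
        rw [h0] at this
        simp at this
      refine ⟨hz, by rw [hm, h0]; simp, Finset.sum_eq_zero fun i hi => by simp [hz i hi]⟩
    · right; left
      obtain ⟨i, hi⟩ := Finset.card_eq_one.1 (le_antisymm (by omega) h1)
      have him : i ∈ S.filter fun i => ξ i ≠ 0 := by rw [hi]; simp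
      rw [Finset.mem_filter] at him
      have hu : ∀ j ∈ S, ξ j ≠ 0 → j = i := fun j hj hne => by
        have : j ∈ S.filter fun i => ξ i ≠ 0 := Finset.mem_filter.2 ⟨hj, hne⟩
        rw [hi] at this
        simpa using this
      refine ⟨i, him.1, him.2, hu, by rw [hm, hi]; simp, ?_⟩
      rw [Finset.sum_eq_single_of_mem i him.1, abs_sign_mul]
      · simp [signInd, him.2]
      · intro j hj hji
        have : ξ j = 0 := by
          by_contra hne
          exact hji (hu j hj hne)
        simp [this]
  · right; right
    rw [hm]
    exact_mod_cast h

/-- A single survivor above `t`, together with a light part below `a`, reaches `v` only if that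
survivor is at least `v'`. With no survivor the light part alone must reach `a`. With `m ≥ 2`
survivors the term `m ^ 2 - m` already exceeds `1`. -/
theorem indicator_rowVal_le (ξ : ι → SignType) (x : ι → ℤ) {v v' a t : ℝ}
    (ha : v' + a ≤ v) (hav : a ≤ v) :
    (if v ≤ |(rowVal ξ x : ℝ)| then (1 : ℝ) else 0) ≤
      ∑ i ∈ Finset.univ.filter (fun i => v' ≤ |(x i : ℝ)|), signInd (ξ i) +
      ((∑ i ∈ Finset.univ.filter (fun i => t ≤ |(x i : ℝ)|), signInd (ξ i)) ^ 2 -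
        ∑ i ∈ Finset.univ.filter (fun i => t ≤ |(x i : ℝ)|), signInd (ξ i)) +
      (if a ≤ |∑ i ∈ Finset.univ.filter (fun i => ¬ t ≤ |(x i : ℝ)|),
        ((ξ i : ℤ) : ℝ) * (x i : ℝ)| then 1 else 0) := by
  have hY := rowVal_eq_add ξ x t
  have hh : 0 ≤ ∑ i ∈ Finset.univ.filter (fun i => v' ≤ |(x i : ℝ)|), signInd (ξ i) :=
    Finset.sum_nonneg fun i _ => signInd_nonneg _
  have hcases := signInd_cases ξ (Finset.univ.filter (fun i => t ≤ |(x i : ℝ)|)) (fun i => x i)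
  set Z := ∑ i ∈ Finset.univ.filter (fun i => ¬ t ≤ |(x i : ℝ)|), ((ξ i : ℤ) : ℝ) * (x i : ℝ)
  set W := ∑ i ∈ Finset.univ.filter (fun i => t ≤ |(x i : ℝ)|), ((ξ i : ℤ) : ℝ) * (x i : ℝ)
  set m := ∑ i ∈ Finset.univ.filter (fun i => t ≤ |(x i : ℝ)|), signInd (ξ i)
  have hI : (0 : ℝ) ≤ if a ≤ |Z| then 1 else 0 := by split_ifs <;> simp
  rcases hcases with ⟨-, hm, hW⟩ | ⟨i, hi, hne, -, hm, hW⟩ | hm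
  · rw [hm, hY, hW, zero_add]
    by_cases hZ : a ≤ |Z|
    · rw [if_pos hZ]; split_ifs <;> linarith
    · rw [if_neg (fun h => hZ (hav.trans h)), if_neg hZ]; linarith
  · rw [hm]
    by_cases hZ : a ≤ |Z|
    · rw [if_pos hZ]; split_ifs <;> linarith
    · by_cases hv : v ≤ |(rowVal ξ x : ℝ)|
      · have hx : v' ≤ |(x i : ℝ)| := by
          have := abs_add_le W Z
          rw [← hY, hW] at this
          linarith
        have h1 : signInd (ξ i) ≤
            ∑ i ∈ Finset.univ.filter (fun i => v' ≤ |(x i : ℝ)|), signInd (ξ i) :=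
          Finset.single_le_sum (f := fun i => signInd (ξ i)) (fun i _ => signInd_nonneg _) (by simp [hx])
        have h2 : signInd (ξ i) = 1 := by simp [signInd, hne]
        rw [if_pos hv]
        linarith
      · rw [if_neg hv]; linarith
  · have : 2 ≤ m ^ 2 - m := by nlinarith
    split_ifs <;> linarith

/-- A lone survivor of size at least `v'` cannot be pushed below `v` by a light part smaller than
`a`. In a collision the left side is nonpositive: since `t ≤ v'`, the first sum is at most `m`, and
`m - (m ^ 2 - m) ≤ 0` for `m ≥ 2`. -/
theorem le_indicator_rowVal (ξ : ι → SignType) (x : ι → ℤ) {v v' a t : ℝ}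
    (ha : v + a ≤ v') (ht : t ≤ v') :
    ∑ i ∈ Finset.univ.filter (fun i => v' ≤ |(x i : ℝ)|), signInd (ξ i) -
      ((∑ i ∈ Finset.univ.filter (fun i => t ≤ |(x i : ℝ)|), signInd (ξ i)) ^ 2 -
        ∑ i ∈ Finset.univ.filter (fun i => t ≤ |(x i : ℝ)|), signInd (ξ i)) -
      (if a ≤ |∑ i ∈ Finset.univ.filter (fun i => ¬ t ≤ |(x i : ℝ)|),
        ((ξ i : ℤ) : ℝ) * (x i : ℝ)| then 1 else 0) ≤
      (if v ≤ |(rowVal ξ x : ℝ)| then (1 : ℝ) else 0) := by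
  have hY := rowVal_eq_add ξ x t
  have hsub : Finset.univ.filter (fun i => v' ≤ |(x i : ℝ)|) ⊆
      Finset.univ.filter (fun i => t ≤ |(x i : ℝ)|) :=
    Finset.monotone_filter_right _ fun i _ h => ht.trans h
  have hh : ∑ i ∈ Finset.univ.filter (fun i => v' ≤ |(x i : ℝ)|), signInd (ξ i) ≤
      ∑ i ∈ Finset.univ.filter (fun i => t ≤ |(x i : ℝ)|), signInd (ξ i) :=
    Finset.sum_le_sum_of_subset_of_nonneg hsub fun i _ _ => signInd_nonneg _
  have hcases := signInd_cases ξ (Finset.univ.filter (fun i => t ≤ |(x i : ℝ)|)) (fun i => x i)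
  set Z := ∑ i ∈ Finset.univ.filter (fun i => ¬ t ≤ |(x i : ℝ)|), ((ξ i : ℤ) : ℝ) * (x i : ℝ)
  set W := ∑ i ∈ Finset.univ.filter (fun i => t ≤ |(x i : ℝ)|), ((ξ i : ℤ) : ℝ) * (x i : ℝ)
  set m := ∑ i ∈ Finset.univ.filter (fun i => t ≤ |(x i : ℝ)|), signInd (ξ i)
  have hI : (0 : ℝ) ≤ if a ≤ |Z| then 1 else 0 := by split_ifs <;> simp
  have hI' : (0 : ℝ) ≤ if v ≤ |(rowVal ξ x : ℝ)| then 1 else 0 := by split_ifs <;> simp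
  rcases hcases with ⟨-, hm, hW⟩ | ⟨i, hi, hne, hu, hm, hW⟩ | hm
  · rw [hm] at hh ⊢
    linarith
  · rw [hm] at hh ⊢
    by_cases hZ : a ≤ |Z|
    · rw [if_pos hZ]; linarith
    · by_cases hx : v' ≤ |(x i : ℝ)|
      · have hv : v ≤ |(rowVal ξ x : ℝ)| := by
          have := abs_sub_abs_le_abs_sub W (-Z)
          rw [abs_neg, sub_neg_eq_add, ← hY, hW] at this
          linarith
        rw [if_pos hv]
        linarith
      · have : ∑ i ∈ Finset.univ.filter (fun i => v' ≤ |(x i : ℝ)|), signInd (ξ i) = 0 := by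
          refine Finset.sum_eq_zero fun j hj => ?_
          by_cases h0 : ξ j = 0
          · simp [signInd, h0]
          · exact absurd (hu j (hsub hj) h0 ▸ (Finset.mem_filter.1 hj).2) hx
        rw [this]
        linarith
  · nlinarith

variable [DecidableEq ι]

/-- The probability that a random sparse row has an entry of absolute value at least `v`. -/
noncomputable def rowProb (q : ℝ) (x : ι → ℤ) (v : ℝ) : ℝ :=
  prodExp (fun _ => signWeight q) (fun ξ : ι → SignType => if v ≤ |(rowVal ξ x : ℝ)| then 1 else 0)

/-- The mean equals `1 + q * (cosh u - 1)`, and `cosh u ≤ 1 + u ^ 2` on `|u| ≤ 1`. The factor `q`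
survives in the exponent, so sparsity improves the tail bound. -/
theorem sign_mgf_le {q u : ℝ} (h0 : 0 ≤ q) (hu : |u| ≤ 1) :
    ∑ s, signWeight q s * Real.exp (((s : ℤ) : ℝ) * u) ≤ Real.exp (q * u ^ 2) := by
  have hu2 : u ^ 2 ≤ 1 := (sq_le_one_iff_abs_le_one u).2 hu
  have h1 := Real.cosh_le_exp_half_sq u
  have h2 := abs_le.1 (Real.abs_exp_sub_one_sub_id_le (x := u ^ 2 / 2)
    (by rw [abs_of_nonneg (by positivity)]; linarith))
  have h3 : Real.cosh u ≤ 1 + u ^ 2 := by nlinarith [h2.2, sq_nonneg u]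
  rw [sum_signType]
  have h4 : signWeight q 0 * Real.exp (((0 : SignType) : ℤ) * u) +
      signWeight q (-1) * Real.exp (((-1 : SignType) : ℤ) * u) +
      signWeight q 1 * Real.exp (((1 : SignType) : ℤ) * u) = 1 + q * (Real.cosh u - 1) := by
    rw [Real.cosh_eq]
    simp [signWeight]
    ring
  rw [h4]
  calc 1 + q * (Real.cosh u - 1) ≤ q * u ^ 2 + 1 := by nlinarith
    _ ≤ _ := Real.add_one_le_exp _

/-- An exponential tail bound for the contribution of small coordinates to a random row. -/
theorem prob_light_le {q : ℝ} (h0 : 0 ≤ q) (h1 : q ≤ 1) (x : ι → ℤ) (S : Finset ι) {l a : ℝ}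
    (hS : ∀ i ∈ S, |l * x i| ≤ 1) (hl : 0 ≤ l) :
    prodExp (fun _ => signWeight q) (fun ξ : ι → SignType =>
        if a ≤ |∑ i ∈ S, ((ξ i : ℤ) : ℝ) * (x i : ℝ)| then 1 else 0) ≤
      2 * Real.exp (-(l * a) + q * l ^ 2 * ∑ i ∈ S, (x i : ℝ) ^ 2) := by
  have hP := probWeights_signWeight ι h0 h1
  have mgf : ∀ l : ℝ, (∀ i ∈ S, |l * x i| ≤ 1) →
      prodExp (fun _ => signWeight q) (fun ξ : ι → SignType =>
        Real.exp (l * ∑ i ∈ S, ((ξ i : ℤ) : ℝ) * (x i : ℝ))) ≤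
      Real.exp (q * l ^ 2 * ∑ i ∈ S, (x i : ℝ) ^ 2) := by
    intro l hl
    have e : (fun ξ : ι → SignType => Real.exp (l * ∑ i ∈ S, ((ξ i : ℤ) : ℝ) * (x i : ℝ))) =
        fun ξ => ∏ i, (fun i (s : SignType) =>
          if i ∈ S then Real.exp (((s : ℤ) : ℝ) * (l * x i)) else 1) i (ξ i) := by
      funext ξ
      rw [Finset.prod_ite_mem, Finset.univ_inter, ← Real.exp_sum, Finset.mul_sum]
      congr 1
      exact Finset.sum_congr rfl fun i _ => by ring
    rw [e, prodExp_prod (fun _ => signWeight q) (fun i (s : SignType) =>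
      if i ∈ S then Real.exp (((s : ℤ) : ℝ) * (l * x i)) else 1)]
    have e2 : Real.exp (q * l ^ 2 * ∑ i ∈ S, (x i : ℝ) ^ 2) =
        ∏ i, if i ∈ S then Real.exp (q * (l * x i) ^ 2) else 1 := by
      rw [Finset.prod_ite_mem, Finset.univ_inter, ← Real.exp_sum, Finset.mul_sum]
      congr 1
      exact Finset.sum_congr rfl fun i _ => by ring
    rw [e2]
    refine Finset.prod_le_prod (fun i _ => Finset.sum_nonneg fun s _ =>
      mul_nonneg (hP.nonneg i s) (by split_ifs <;> positivity)) fun i _ => ?_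
    by_cases hi : i ∈ S
    · simp only [hi, if_true]
      exact sign_mgf_le h0 (hl i hi)
    · simp [hi, hP.sum_eq i]
  have m1 := mgf l hS
  have m2 := mgf (-l) (fun i hi => by simpa using hS i hi)
  rw [neg_sq] at m2
  calc _ ≤ prodExp (fun _ => signWeight q) (fun ξ : ι → SignType => Real.exp (-(l * a)) *
          (Real.exp (l * ∑ i ∈ S, ((ξ i : ℤ) : ℝ) * (x i : ℝ)) +
            Real.exp (-l * ∑ i ∈ S, ((ξ i : ℤ) : ℝ) * (x i : ℝ)))) := by
        refine prodExp_mono hP fun ξ => ?_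
        generalize ∑ i ∈ S, ((ξ i : ℤ) : ℝ) * (x i : ℝ) = z
        split_ifs with h
        · rw [mul_add, ← Real.exp_add, ← Real.exp_add]
          rcases le_abs.1 h with h | h
          · have : 1 ≤ Real.exp (-(l * a) + l * z) := Real.one_le_exp (by nlinarith)
            linarith [Real.exp_pos (-(l * a) + -l * z)]
          · have : 1 ≤ Real.exp (-(l * a) + -l * z) := Real.one_le_exp (by nlinarith)
            linarith [Real.exp_pos (-(l * a) + l * z)]
        · positivity
    _ ≤ Real.exp (-(l * a)) * (Real.exp (q * l ^ 2 * ∑ i ∈ S, (x i : ℝ) ^ 2) +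
          Real.exp (q * l ^ 2 * ∑ i ∈ S, (x i : ℝ) ^ 2)) := by
        rw [prodExp_const_mul, prodExp_add]
        gcongr
    _ = _ := by rw [Real.exp_add]; ring

theorem prodExp_sum_signInd {q : ℝ} (h0 : 0 ≤ q) (h1 : q ≤ 1) (S : Finset ι) :
    prodExp (fun _ => signWeight q) (fun ξ : ι → SignType => ∑ i ∈ S, signInd (ξ i)) =
      q * S.card := by
  rw [prodExp_sum]
  simp_rw [prodExp_single (probWeights_signWeight ι h0 h1), sum_signWeight_signInd]
  simp [mul_comm]

/-- The variable counts ordered pairs of distinct survivors, and each pair survives with probability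
`q ^ 2`. -/
theorem prodExp_pairs_signInd {q : ℝ} (h0 : 0 ≤ q) (h1 : q ≤ 1) (S : Finset ι) :
    prodExp (fun _ => signWeight q) (fun ξ : ι → SignType =>
      (∑ i ∈ S, signInd (ξ i)) ^ 2 - ∑ i ∈ S, signInd (ξ i)) ≤ q ^ 2 * (S.card : ℝ) ^ 2 := by
  have e : (fun ξ : ι → SignType => (∑ i ∈ S, signInd (ξ i)) ^ 2 - ∑ i ∈ S, signInd (ξ i)) =
      fun ξ => ∑ i ∈ S, ∑ j ∈ S.erase i, signInd (ξ i) * signInd (ξ j) := by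
    funext ξ
    rw [sq, Finset.sum_mul_sum, ← Finset.sum_sub_distrib]
    refine Finset.sum_congr rfl fun i hi => ?_
    rw [← Finset.add_sum_erase _ _ hi]
    have : signInd (ξ i) * signInd (ξ i) = signInd (ξ i) := by unfold signInd; split_ifs <;> simp
    rw [this]; ring
  rw [e, prodExp_sum]
  calc _ ≤ ∑ i ∈ S, ∑ j ∈ S, q ^ 2 := by
        refine Finset.sum_le_sum fun i _ => ?_
        rw [prodExp_sum]
        calc _ = ∑ j ∈ S.erase i, q ^ 2 := by
              refine Finset.sum_congr rfl fun j hj => ?_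
              rw [prodExp_pair (probWeights_signWeight ι h0 h1) (Finset.ne_of_mem_erase hj).symm,
                sum_signWeight_signInd, sq]
          _ ≤ _ := Finset.sum_le_sum_of_subset_of_nonneg (Finset.erase_subset _ _)
              fun _ _ _ => by positivity
    _ = _ := by simp; ring

/-- Each such coordinate contributes at least `τ ^ 2` to the capped mass. With `sum_light_le`, one
quantity thus controls both the number of medium coordinates and the energy of the light ones. -/
theorem card_medium_le (x : ι → ℤ) {v τ : ℝ} (hv : 0 < v) (h0 : 0 < τ) (h1 : τ ≤ 1) :
    ((Finset.univ.filter fun i => τ * v ≤ |(x i : ℝ)|).card : ℝ) ≤ cappedMass x v / τ ^ 2 := by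
  rw [le_div_iff₀ (by positivity), ← nsmul_eq_mul, ← Finset.sum_const]
  refine (Finset.sum_le_sum fun i hi => ?_).trans
    (Finset.sum_le_sum_of_subset_of_nonneg (Finset.filter_subset _ _) fun i _ _ => by positivity)
  have h := (Finset.mem_filter.1 hi).2
  refine le_min (by nlinarith) ?_
  rw [le_div_iff₀ (by positivity), ← mul_pow, ← sq_abs (x i : ℝ)]
  gcongr

theorem sum_light_le (x : ι → ℤ) {v τ : ℝ} (hv : 0 < v) (h1 : τ ≤ 1) :
    ∑ i ∈ Finset.univ.filter (fun i => ¬ τ * v ≤ |(x i : ℝ)|), (x i : ℝ) ^ 2 ≤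
      v ^ 2 * cappedMass x v := by
  unfold cappedMass
  rw [Finset.mul_sum]
  refine (Finset.sum_le_sum fun i hi => ?_).trans
    (Finset.sum_le_sum_of_subset_of_nonneg (Finset.filter_subset _ _) fun i _ _ => by positivity)
  have h := (Finset.mem_filter.1 hi).2
  have h2 : (x i : ℝ) ^ 2 ≤ v ^ 2 := by
    rw [← sq_abs (x i : ℝ)]
    have : |(x i : ℝ)| ≤ v := by nlinarith
    gcongr
  rw [min_eq_right ((div_le_one (by positivity)).2 h2)]
  field_simp
  exact le_rfl

/-- The error term in the comparison of `rowProb` with `countGe`. -/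
noncomputable def rowError (q τ a h : ℝ) : ℝ :=
  q ^ 2 * (h / τ ^ 2) ^ 2 + 2 * Real.exp (-(a / τ) + q * h / τ ^ 2)

/-- Both parts average the pointwise bounds with cutoff `t = τ * v`. The collisions give the first
summand of `rowError` and the light part gives the second. The tail bound is used at rate `1 / (τ *
v)`, which keeps all light exponents within `[-1, 1]`. -/
theorem rowProb_bounds {q : ℝ} (hq0 : 0 ≤ q) (hq1 : q ≤ 1) (x : ι → ℤ) {v τ a h : ℝ}
    (hv : 0 < v) (h0 : 0 < τ) (h1 : τ ≤ 1) (hh : cappedMass x v ≤ h) :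
    (∀ v', v' + a * v ≤ v → a ≤ 1 → rowProb q x v ≤ q * countGe x v' + rowError q τ a h) ∧
    (∀ v', v + a * v ≤ v' → 0 ≤ a → q * countGe x v' ≤ rowProb q x v + rowError q τ a h) := by
  have hP := probWeights_signWeight ι hq0 hq1
  have hm := prodExp_pairs_signInd hq0 hq1 (Finset.univ.filter fun i => τ * v ≤ |(x i : ℝ)|)
  have hm' : q ^ 2 * ((Finset.univ.filter fun i => τ * v ≤ |(x i : ℝ)|).card : ℝ) ^ 2 ≤
      q ^ 2 * (h / τ ^ 2) ^ 2 := by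
    have := (card_medium_le x hv h0 h1).trans (div_le_div_of_nonneg_right hh (by positivity))
    gcongr
  have hZ := prob_light_le (a := a * v) (l := 1 / (τ * v)) hq0 hq1 x
    (Finset.univ.filter (fun i => ¬ τ * v ≤ |(x i : ℝ)|)) (fun i hi => by
      have h := (Finset.mem_filter.1 hi).2
      have hp : 0 < τ * v := by positivity
      rw [abs_mul, abs_of_pos (by positivity), one_div, inv_mul_le_iff₀ hp]
      linarith) (by positivity)
  have hZ' : 2 * Real.exp (-(1 / (τ * v) * (a * v)) + q * (1 / (τ * v)) ^ 2 *
      ∑ i ∈ Finset.univ.filter (fun i => ¬ τ * v ≤ |(x i : ℝ)|), (x i : ℝ) ^ 2) ≤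
      2 * Real.exp (-(a / τ) + q * h / τ ^ 2) := by
    gcongr 2 * Real.exp (?_ + ?_)
    · apply le_of_eq; field_simp
    · calc _ ≤ q * (1 / (τ * v)) ^ 2 * (v ^ 2 * h) := by
            gcongr
            exact (sum_light_le x hv h1).trans (by gcongr)
        _ = _ := by field_simp
  constructor
  · intro v' hv' ha
    have key := prodExp_mono hP fun ξ => indicator_rowVal_le ξ x (t := τ * v) hv' (by nlinarith)
    rw [prodExp_add, prodExp_add, prodExp_sum_signInd hq0 hq1] at key
    unfold rowProb rowError countGe
    linarith
  · intro v' hv' ha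
    have key := prodExp_mono hP fun ξ => le_indicator_rowVal ξ x (t := τ * v) hv' (by nlinarith)
    rw [prodExp_sub, prodExp_sub, prodExp_sum_signInd hq0 hq1] at key
    unfold rowProb rowError countGe
    linarith

end rowVal

/-! ### Order statistics of the absolute values -/

theorem sum_map_eq_sum_getD (l : List ℕ) (f : ℕ → ℝ) :
    (l.map f).sum = ∑ j ∈ Finset.range l.length, f (l.getD j 0) := by
  induction l with
  | nil => simp
  | cons a l ih =>
    rw [List.map_cons, List.sum_cons, List.length_cons, Finset.sum_range_succ', ih, add_comm]
    simp

section topAbs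

variable {n : ℕ}

theorem sortedAbs_perm (x : Fin n → ℤ) :
    (sortedAbs x).Perm (List.ofFn fun j => (x j).natAbs) :=
  List.perm_insertionSort _ _

theorem length_sortedAbs (x : Fin n → ℤ) : (sortedAbs x).length = n := by
  rw [(sortedAbs_perm x).length_eq, List.length_ofFn]

theorem pairwise_sortedAbs (x : Fin n → ℤ) : (sortedAbs x).Pairwise fun s t => t ≤ s := by
  have : Std.Total (fun s t : ℕ => t ≤ s) := ⟨fun a b => le_total b a⟩
  have : IsTrans ℕ (fun s t : ℕ => t ≤ s) := ⟨fun a b c h1 h2 => h2.trans h1⟩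
  exact List.pairwise_insertionSort _ _

theorem topAbs_anti (x : Fin n → ℤ) {i j : ℕ} (hij : i ≤ j) : topAbs x j ≤ topAbs x i := by
  unfold topAbs
  rcases Nat.lt_or_ge (j - 1) (sortedAbs x).length with hj | hj
  · have hi : i - 1 < (sortedAbs x).length := by omega
    rw [List.getD_eq_getElem _ _ hj, List.getD_eq_getElem _ _ hi]
    rcases Nat.lt_or_ge (i - 1) (j - 1) with h | h
    · exact List.pairwise_iff_getElem.1 (pairwise_sortedAbs x) _ _ hi hj h
    · have : i - 1 = j - 1 := by omega
      simp [this]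
  · rw [List.getD_eq_default _ _ hj]
    exact Nat.zero_le _

theorem sum_topAbs (x : Fin n → ℤ) (f : ℕ → ℝ) :
    ∑ i ∈ Finset.Icc 1 n, f (topAbs x i) = ∑ j, f (x j).natAbs := by
  have h1 : ((sortedAbs x).map f).sum = ∑ j, f (x j).natAbs := by
    rw [((sortedAbs_perm x).map f).sum_eq, List.map_ofFn, List.sum_ofFn]
    rfl
  have h4 : Finset.Icc 1 n = Finset.Ico (0 + 1) (n + 1) := by
    ext i
    simp only [Finset.mem_Icc, Finset.mem_Ico]
    omega
  rw [← h1, sum_map_eq_sum_getD, length_sortedAbs, Finset.range_eq_Ico, h4, ← Finset.sum_Ico_add' (fun i => f (topAbs x i)) 0 n 1]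
  rfl

theorem cappedMass_eq_sum_topAbs (x : Fin n → ℤ) (v : ℝ) :
    cappedMass x v = ∑ i ∈ Finset.Icc 1 n, min 1 ((topAbs x i : ℝ) ^ 2 / v ^ 2) := by
  rw [sum_topAbs x fun t => min 1 ((t : ℝ) ^ 2 / v ^ 2)]
  refine Finset.sum_congr rfl fun i _ => ?_
  rw [Nat.cast_natAbs, Int.cast_abs, sq_abs]

theorem countGe_eq_card (x : Fin n → ℤ) (v : ℝ) :
    countGe x v = ((Finset.Icc 1 n).filter fun i => v ≤ topAbs x i).card := by
  have h := sum_topAbs x fun t => if v ≤ (t : ℝ) then 1 else 0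
  have h' : (countGe x v : ℝ) = ∑ j, if v ≤ ((x j).natAbs : ℝ) then (1 : ℝ) else 0 := by
    simp only [countGe, Finset.card_filter, Nat.cast_natAbs, Int.cast_abs]
    push_cast
    rfl
  rw [← h, ← Nat.cast_one, ← Nat.cast_zero] at h'
  rw [Finset.card_filter]
  exact_mod_cast h'

theorem le_topAbs_iff (x : Fin n → ℤ) {v : ℝ} {i : ℕ} (h1 : 1 ≤ i) (hn : i ≤ n) :
    v ≤ topAbs x i ↔ i ≤ countGe x v := by
  rw [countGe_eq_card]
  constructor
  · intro h
    have : Finset.Icc 1 i ⊆ (Finset.Icc 1 n).filter fun i => v ≤ topAbs x i := fun j hj => by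
      rw [Finset.mem_Icc] at hj
      refine Finset.mem_filter.2 ⟨Finset.mem_Icc.2 ⟨hj.1, hj.2.trans hn⟩, h.trans ?_⟩
      exact_mod_cast topAbs_anti x hj.2
    simpa using Finset.card_le_card this
  · intro h
    by_contra hcon
    have : ((Finset.Icc 1 n).filter fun i => v ≤ topAbs x i) ⊆ Finset.Ico 1 i := fun j hj => by
      obtain ⟨hj1, hj2⟩ := Finset.mem_filter.1 hj
      rw [Finset.mem_Icc] at hj1
      refine Finset.mem_Ico.2 ⟨hj1.1, ?_⟩
      by_contra hij
      refine hcon (hj2.trans ?_)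
      exact_mod_cast topAbs_anti x (not_lt.1 hij)
    have := Finset.card_le_card this
    rw [Nat.card_Ico] at this
    omega

theorem topAbs_le (x : Fin n → ℤ) {m : ℕ} (hx : ∀ i, |x i| ≤ (m : ℤ)) (i : ℕ) :
    topAbs x i ≤ m := by
  unfold topAbs
  rcases Nat.lt_or_ge (i - 1) (sortedAbs x).length with hi | hi
  · rw [List.getD_eq_getElem _ _ hi]
    have hmem := (sortedAbs_perm x).mem_iff.1 (List.getElem_mem hi)
    obtain ⟨j, hj⟩ := (List.mem_ofFn' _ _).1 hmem
    rw [← hj]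
    have := hx j
    rw [Int.abs_eq_natAbs] at this
    exact_mod_cast this
  · rw [List.getD_eq_default _ _ hi]
    exact Nat.zero_le _

end topAbs

/-! ### Powers with the convention `0 ^ 0 = 0` -/

theorem freqPow_nonneg (p : ℝ) (t : ℕ) : 0 ≤ freqPow p t := by
  unfold freqPow; split_ifs <;> positivity

theorem freqPow_mono {p : ℝ} (hp : 0 ≤ p) {s t : ℕ} (h : s ≤ t) : freqPow p s ≤ freqPow p t := by
  by_cases hs : s = 0
  · simpa [freqPow, hs] using freqPow_nonneg p t
  · have ht : t ≠ 0 := by omega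
    simp only [freqPow, hs, ht, if_false]
    exact Real.rpow_le_rpow (by positivity) (by exact_mod_cast h) hp

theorem rpow_le_freqPow {p v : ℝ} (hp : 0 ≤ p) (hv : 0 < v) {t : ℕ} (h : v ≤ t) :
    v ^ p ≤ freqPow p t := by
  have ht : t ≠ 0 := by
    rintro rfl
    simp at h
    linarith
  simp only [freqPow, ht, if_false]
  exact Real.rpow_le_rpow hv.le h hp

theorem freqPow_le_mul {p c v : ℝ} (hp0 : 0 ≤ p) (hp2 : p ≤ 2) (hc : 1 ≤ c) (hv : 0 ≤ v) {t : ℕ}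
    (h : t ≤ c * v) : freqPow p t ≤ c ^ 2 * v ^ p := by
  unfold freqPow
  split_ifs
  · positivity
  · calc (t : ℝ) ^ p ≤ (c * v) ^ p := Real.rpow_le_rpow (by positivity) h hp0
      _ = c ^ p * v ^ p := Real.mul_rpow (by linarith) hv
      _ ≤ c ^ (2 : ℝ) * v ^ p := by gcongr
      _ = _ := by norm_cast

theorem freqPow_le_mul_freqPow {p c : ℝ} (hp0 : 0 ≤ p) (hp2 : p ≤ 2) (hc : 1 ≤ c) {s t : ℕ}
    (h : (t : ℝ) ≤ c * s) : freqPow p t ≤ c ^ 2 * freqPow p s := by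
  by_cases hs : s = 0
  · have ht : t = 0 := by
      have : (t : ℝ) ≤ 0 := by simpa [hs] using h
      exact_mod_cast le_antisymm this (by positivity)
    simp [freqPow, hs, ht]
  · have := freqPow_le_mul hp0 hp2 hc (by positivity) h
    simpa [freqPow, hs] using this

/-- Below `v` the quotient of the two sides is `(t / v) ^ (2 - p)`. This is where `p ≤ 2` is
essential. -/
theorem rpow_mul_min_le {p v : ℝ} (hp2 : p ≤ 2) (hp0 : 0 ≤ p) (hv : 0 < v) (t : ℕ) :
    v ^ p * min 1 ((t : ℝ) ^ 2 / v ^ 2) ≤ freqPow p t := by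
  by_cases ht : t = 0
  · simp [ht, freqPow]
  · have htp : 0 < (t : ℝ) := by positivity
    rcases le_total v t with h | h
    · calc _ ≤ v ^ p * 1 := by gcongr; exact min_le_left _ _
        _ ≤ _ := by rw [mul_one]; exact rpow_le_freqPow hp0 hv h
    · simp only [freqPow, ht, if_false]
      calc _ ≤ v ^ p * ((t : ℝ) ^ 2 / v ^ 2) := by gcongr; exact min_le_right _ _
        _ = t ^ p * ((t : ℝ) / v) ^ (2 - p) := by
          rw [Real.div_rpow htp.le hv.le, Real.rpow_sub htp, Real.rpow_sub hv]
          norm_cast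
          field_simp
        _ ≤ t ^ p * 1 := by
          gcongr
          exact Real.rpow_le_one (by positivity) ((div_le_one hv).2 h) (by linarith)
        _ = _ := mul_one _

/-! ### Comparing trimmed moments through counting functions -/

section comparison

variable {n : ℕ}

theorem trimmedMoment_nonneg (x : Fin n → ℤ) (k : ℕ) (p : ℝ) : 0 ≤ trimmedMoment x k p :=
  Finset.sum_nonneg fun _ _ => freqPow_nonneg _ _

/-- The ranks split into three ranges. Those before `k` are capped at `v ^ p`, the middle ones are
charged to the trimmed moment, and each of the last `k` is at most the value at rank `k` because `k
≤ n - k`. -/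
theorem rpow_mul_cappedMass_le {k : ℕ} {p v : ℝ} (hp0 : 0 ≤ p) (hp2 : p ≤ 2) (hk : 2 * k ≤ n)
    (hv : 0 < v) (z : Fin n → ℤ) :
    v ^ p * cappedMass z v ≤
      k * v ^ p + trimmedMoment z k p + k * freqPow p (topAbs z k) := by
  rw [cappedMass_eq_sum_topAbs, Finset.mul_sum]
  have hpt : ∀ i ∈ Finset.Icc 1 n, v ^ p * min 1 ((topAbs z i : ℝ) ^ 2 / v ^ 2) ≤
      (if i ∈ Finset.Icc 1 k then v ^ p else 0) +
      (if i ∈ Finset.Icc (max 1 k) (n - k) then freqPow p (topAbs z i) else 0) +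
      (if i ∈ Finset.Ioc (n - k) n then freqPow p (topAbs z k) else 0) := by
    intro i hi
    rw [Finset.mem_Icc] at hi
    have hf := rpow_mul_min_le hp2 hp0 hv (topAbs z i)
    have hvp : 0 ≤ v ^ p := by positivity
    have h1 : 0 ≤ if i ∈ Finset.Icc 1 k then v ^ p else 0 := by split_ifs <;> simp [hvp]
    have h2 : 0 ≤ if i ∈ Finset.Icc (max 1 k) (n - k) then freqPow p (topAbs z i) else 0 := by
      split_ifs <;> simp [freqPow_nonneg]
    have h3 : 0 ≤ if i ∈ Finset.Ioc (n - k) n then freqPow p (topAbs z k) else 0 := by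
      split_ifs <;> simp [freqPow_nonneg]
    rcases Nat.lt_or_ge i (max 1 k) with h | h
    · have hm : i ∈ Finset.Icc 1 k := by rw [Finset.mem_Icc]; omega
      rw [if_pos hm] at h1 ⊢
      have : v ^ p * min 1 ((topAbs z i : ℝ) ^ 2 / v ^ 2) ≤ v ^ p * 1 := by
        gcongr; exact min_le_left _ _
      linarith
    · rcases Nat.lt_or_ge (n - k) i with h' | h'
      · have hm : i ∈ Finset.Ioc (n - k) n := by rw [Finset.mem_Ioc]; omega
        rw [if_pos hm] at h3 ⊢
        have := freqPow_mono hp0 (topAbs_anti z (show k ≤ i by omega))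
        linarith
      · have hm : i ∈ Finset.Icc (max 1 k) (n - k) := by rw [Finset.mem_Icc]; omega
        rw [if_pos hm] at h2 ⊢
        linarith
  refine (Finset.sum_le_sum hpt).trans ?_
  have s1 : Finset.Icc 1 n ∩ Finset.Icc 1 k = Finset.Icc 1 k :=
    Finset.inter_eq_right.2 (Finset.Icc_subset_Icc le_rfl (by omega))
  have s2 : Finset.Icc 1 n ∩ Finset.Icc (max 1 k) (n - k) = Finset.Icc (max 1 k) (n - k) :=
    Finset.inter_eq_right.2 (Finset.Icc_subset_Icc (le_max_left _ _) (by omega))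
  have s3 : Finset.Icc 1 n ∩ Finset.Ioc (n - k) n = Finset.Ioc (n - k) n :=
    Finset.inter_eq_right.2 fun i hi => by
      rw [Finset.mem_Ioc] at hi
      rw [Finset.mem_Icc]
      omega
  rw [Finset.sum_add_distrib, Finset.sum_add_distrib, Finset.sum_ite_mem, Finset.sum_ite_mem,
    Finset.sum_ite_mem, s1, s2, s3, Finset.sum_const, Finset.sum_const, Nat.card_Icc, Nat.card_Ioc]
  have : n - (n - k) = k := by omega
  simp [this, trimmedMoment]

/-- The total error scale in the comparison of two vectors. -/
noncomputable def comparisonScale (k : ℕ) (p : ℝ) (x y : Fin n → ℤ) : ℝ :=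
  trimmedMoment x k p + trimmedMoment y k p + k * freqPow p (topAbs x k) +
    3 * (k * freqPow p (topAbs y k))

theorem comparisonScale_nonneg (k : ℕ) (p : ℝ) (x y : Fin n → ℤ) :
    0 ≤ comparisonScale k p x y := by
  have := trimmedMoment_nonneg x k p
  have := trimmedMoment_nonneg y k p
  have := freqPow_nonneg p (topAbs x k)
  have := freqPow_nonneg p (topAbs y k)
  unfold comparisonScale
  positivity

/-- The head terms `k * v ^ p` of both vectors are charged to rank `k` of `y`. With the tail term of
`y` itself this accounts for the coefficient `3` in `comparisonScale`. -/
theorem rpow_mul_cappedMass_add_le {k : ℕ} {p v : ℝ} (hp0 : 0 ≤ p) (hp2 : p ≤ 2)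
    (hk : 2 * k ≤ n) (hv : 0 < v) (x y : Fin n → ℤ) (hy : 1 ≤ k → v ≤ topAbs y k) :
    v ^ p * (cappedMass x v + cappedMass y v) ≤ comparisonScale k p x y := by
  have h1 := rpow_mul_cappedMass_le hp0 hp2 hk hv x
  have h2 := rpow_mul_cappedMass_le hp0 hp2 hk hv y
  have h3 : k * v ^ p ≤ k * freqPow p (topAbs y k) := by
    rcases Nat.eq_zero_or_pos k with h | h
    · simp [h]
    · gcongr
      exact rpow_le_freqPow hp0 hv (hy h)
  unfold comparisonScale
  linarith

/-- `y` has hardly more large coordinates than `x`, at all scales `β ^ t`. -/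
def CountDominated (β η : ℝ) (L : ℕ) (x y : Fin n → ℤ) : Prop :=
  ∀ t ≤ L, (countGe y (β ^ t) : ℝ) ≤ countGe x (β ^ t / β ^ 2) +
    η * (cappedMass x (β ^ t) + cappedMass y (β ^ t))

theorem exists_scale {β : ℝ} (hβ : 1 < β) {L a : ℕ} (ha : a ≠ 0) (haL : a ≤ β ^ L) :
    ∃ t ≤ L, β ^ t ≤ a ∧ (a : ℝ) < β ^ (t + 1) := by
  obtain ⟨t, h1, h2⟩ := exists_nat_pow_near
    (show (1 : ℝ) ≤ a by exact_mod_cast Nat.one_le_iff_ne_zero.2 ha) hβ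
  exact ⟨t, (pow_le_pow_iff_right₀ hβ).1 (h1.trans haL), h1, h2⟩

/-- The bad ranks lie between the two counts `countGe x (β ^ t / β ^ 2)` and `countGe y (β ^ t)`, so
domination bounds their number. -/
theorem card_bad_ranks_le {k L t : ℕ} {p β η : ℝ} (hp0 : 0 ≤ p) (hp2 : p ≤ 2) (hk : 2 * k ≤ n)
    (hβ : 1 < β) (hη : 0 ≤ η) {x y : Fin n → ℤ} (h : CountDominated β η L x y) (ht : t ≤ L) :
    (((Finset.Icc (max 1 k) (n - k)).filter fun i =>
      β ^ t ≤ topAbs y i ∧ (topAbs x i : ℝ) < β ^ t / β ^ 2).card : ℝ) * (β ^ t) ^ p ≤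
      η * comparisonScale k p x y := by
  set S := (Finset.Icc (max 1 k) (n - k)).filter fun i =>
      β ^ t ≤ topAbs y i ∧ (topAbs x i : ℝ) < β ^ t / β ^ 2
  have hs := comparisonScale_nonneg k p x y
  have hβt : 0 < β ^ t := by positivity
  rcases S.eq_empty_or_nonempty with hS | ⟨i, hi⟩
  · rw [hS]
    simpa using mul_nonneg hη hs
  have hmem : ∀ i ∈ S, countGe x (β ^ t / β ^ 2) < i ∧ i ≤ countGe y (β ^ t) := by
    intro i hi
    obtain ⟨h1, h2, h3⟩ := Finset.mem_filter.1 hi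
    rw [Finset.mem_Icc] at h1
    constructor
    · by_contra hcon
      exact absurd ((le_topAbs_iff x (by omega) (by omega)).2 (not_lt.1 hcon))
        (not_le.2 h3)
    · exact (le_topAbs_iff y (by omega) (by omega)).1 h2
  have hcard : (S.card : ℝ) ≤ η * (cappedMass x (β ^ t) + cappedMass y (β ^ t)) := by
    have h1 : S.card ≤ countGe y (β ^ t) - countGe x (β ^ t / β ^ 2) := by
      rw [← Nat.card_Ioc]
      exact Finset.card_le_card fun i hi => Finset.mem_Ioc.2 (hmem i hi)
    have h2 : countGe x (β ^ t / β ^ 2) ≤ countGe y (β ^ t) :=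
      ((hmem i hi).1.trans_le (hmem i hi).2).le
    have h3 : (S.card : ℝ) ≤ countGe y (β ^ t) - countGe x (β ^ t / β ^ 2) := by
      rw [← Nat.cast_sub h2]
      exact_mod_cast h1
    linarith [h t ht]
  -- The existence of one bad rank `i ≥ k` puts the whole head of `y` above `β ^ t`, so the capped
  -- head can be charged to it.
  have hyk : 1 ≤ k → β ^ t ≤ topAbs y k := fun _ => by
    obtain ⟨h1, h2, -⟩ := Finset.mem_filter.1 hi
    rw [Finset.mem_Icc] at h1
    exact h2.trans (by exact_mod_cast topAbs_anti y (show k ≤ i by omega))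
  calc _ ≤ η * (cappedMass x (β ^ t) + cappedMass y (β ^ t)) * (β ^ t) ^ p := by gcongr
    _ = η * ((β ^ t) ^ p * (cappedMass x (β ^ t) + cappedMass y (β ^ t))) := by ring
    _ ≤ _ := by gcongr; exact rpow_mul_cappedMass_add_le hp0 hp2 hk hβt x y hyk

/-- Let `t` be the scale of the value of `y` at rank `i`. Either rank `i` is bad at scale `t`, or
the value is at most `β ^ 3` times that of `x`, which costs at most `β ^ 6` since `p ≤ 2`. The `L +
1` scales of bad ranks are summed. -/
theorem trimmedMoment_le {k L : ℕ} {p β η : ℝ} (hp0 : 0 ≤ p) (hp2 : p ≤ 2) (hk : 2 * k ≤ n)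
    (hβ : 1 < β) (hη : 0 ≤ η) {x y : Fin n → ℤ} (h : CountDominated β η L x y)
    (hy : ∀ i, (topAbs y i : ℝ) ≤ β ^ L) :
    trimmedMoment y k p ≤ β ^ 6 * trimmedMoment x k p +
      (L + 1) * (β ^ 2 * (η * comparisonScale k p x y)) := by
  have hpt : ∀ i ∈ Finset.Icc (max 1 k) (n - k), freqPow p (topAbs y i) ≤
      β ^ 6 * freqPow p (topAbs x i) + ∑ t ∈ Finset.range (L + 1),
        if β ^ t ≤ topAbs y i ∧ (topAbs x i : ℝ) < β ^ t / β ^ 2 then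
          β ^ 2 * (β ^ t) ^ p else 0 := by
    intro i _
    have hnn : ∀ t ∈ Finset.range (L + 1),
        0 ≤ if β ^ t ≤ topAbs y i ∧ (topAbs x i : ℝ) < β ^ t / β ^ 2 then
          β ^ 2 * (β ^ t) ^ p else 0 := fun t _ => by split_ifs <;> positivity
    have hxn := freqPow_nonneg p (topAbs x i)
    by_cases h0 : topAbs y i = 0
    · have : freqPow p (topAbs y i) = 0 := by simp [freqPow, h0]
      rw [this]
      have := Finset.sum_nonneg hnn
      positivity
    · obtain ⟨t, htL, h1, h2⟩ := exists_scale hβ h0 (hy i)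
      rcases lt_or_ge (topAbs x i : ℝ) (β ^ t / β ^ 2) with hx | hx
      · have hle := Finset.single_le_sum hnn (Finset.mem_range.2 (Nat.lt_succ_of_le htL))
        rw [if_pos ⟨h1, hx⟩] at hle
        have := freqPow_le_mul (v := β ^ t) hp0 hp2 hβ.le (by positivity)
          (show (topAbs y i : ℝ) ≤ β * β ^ t by rw [← pow_succ']; exact h2.le)
        have : 0 ≤ β ^ 6 * freqPow p (topAbs x i) := by positivity
        linarith
      · have := freqPow_le_mul_freqPow (c := β ^ 3) hp0 hp2 (one_le_pow₀ hβ.le)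
          (show (topAbs y i : ℝ) ≤ β ^ 3 * topAbs x i by
            rw [div_le_iff₀ (by positivity)] at hx
            calc (topAbs y i : ℝ) ≤ β * β ^ t := by rw [← pow_succ']; exact h2.le
              _ ≤ β * (topAbs x i * β ^ 2) := by gcongr
              _ = _ := by ring)
        rw [show (β ^ 3) ^ 2 = β ^ 6 by ring] at this
        linarith [Finset.sum_nonneg hnn]
  unfold trimmedMoment at *
  refine (Finset.sum_le_sum hpt).trans ?_
  rw [Finset.sum_add_distrib, Finset.mul_sum, Finset.sum_comm]
  gcongr
  calc _ ≤ ∑ t ∈ Finset.range (L + 1), β ^ 2 * (η * comparisonScale k p x y) := by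
        refine Finset.sum_le_sum fun t ht => ?_
        rw [← Finset.sum_filter, Finset.sum_const, nsmul_eq_mul]
        have := card_bad_ranks_le hp0 hp2 hk hβ hη h (Nat.le_of_lt_succ (Finset.mem_range.1 ht))
        calc _ = β ^ 2 * (_ * (β ^ t) ^ p) := by ring
          _ ≤ _ := by gcongr
    _ = _ := by simp

/-- At the scale of the `k`-th value of `y`, either the counting error is at most `ε * k`, and then
`x` still has `⌈k - ε * k⌉` coordinates of about that size, or `ε * k` is itself dominated by the
capped masses. -/
theorem freqPow_topAbs_le {k L : ℕ} {p β η ε : ℝ} (hp0 : 0 ≤ p) (hp2 : p ≤ 2) (hk : 2 * k ≤ n)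
    (hβ : 1 < β) (hη : 0 ≤ η) (hε0 : 0 < ε) (hε1 : ε < 1) (hk1 : 1 ≤ k)
    {x y : Fin n → ℤ} (h : CountDominated β η L x y)
    (hy : ∀ i, (topAbs y i : ℝ) ≤ β ^ L) :
    k * freqPow p (topAbs y k) ≤
        β ^ 6 * (k * freqPow p (topAbs x ⌈(k : ℝ) - ε * (k : ℝ)⌉₊)) ∨
      ε * (k * freqPow p (topAbs y k)) ≤ β ^ 2 * (η * comparisonScale k p x y) := by
  have hkp : (0 : ℝ) < k := by exact_mod_cast hk1
  have hs := comparisonScale_nonneg k p x y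
  by_cases h0 : topAbs y k = 0
  · right
    have : freqPow p (topAbs y k) = 0 := by simp [freqPow, h0]
    rw [this]
    simp only [mul_zero]
    positivity
  obtain ⟨t, htL, h1, h2⟩ := exists_scale hβ h0 (hy k)
  have h2' : (topAbs y k : ℝ) ≤ β * β ^ t := by rw [← pow_succ']; exact h2.le
  have hβt : 0 < β ^ t := by positivity
  have hcount : k ≤ countGe y (β ^ t) := (le_topAbs_iff y hk1 (by omega)).1 h1
  have hcount' : (k : ℝ) ≤ countGe y (β ^ t) := by exact_mod_cast hcount
  have hdom := h t htL
  rcases le_or_gt (η * (cappedMass x (β ^ t) + cappedMass y (β ^ t))) (ε * k) with he | he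
  · left
    set r := ⌈(k : ℝ) - ε * (k : ℝ)⌉₊
    have hr0 : 1 ≤ r := Nat.one_le_ceil_iff.2 (by nlinarith)
    have hrk : r ≤ k := Nat.ceil_le.2 (by nlinarith)
    have hr : r ≤ countGe x (β ^ t / β ^ 2) := Nat.ceil_le.2 (by linarith)
    have hx := (le_topAbs_iff x hr0 (by omega)).2 hr
    have := freqPow_le_mul_freqPow (c := β ^ 3) hp0 hp2 (one_le_pow₀ hβ.le)
      (show (topAbs y k : ℝ) ≤ β ^ 3 * topAbs x r by
        rw [div_le_iff₀ (by positivity)] at hx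
        calc (topAbs y k : ℝ) ≤ β * β ^ t := h2'
          _ ≤ β * (topAbs x r * β ^ 2) := by gcongr
          _ = _ := by ring)
    rw [← pow_mul] at this
    calc _ ≤ (k : ℝ) * (β ^ (3 * 2) * freqPow p (topAbs x r)) := by gcongr
      _ = _ := by ring
  · right
    have hf := freqPow_le_mul (v := β ^ t) hp0 hp2 hβ.le (by positivity) h2'
    calc ε * (k * freqPow p (topAbs y k)) = (ε * k) * freqPow p (topAbs y k) := by ring
      _ ≤ (η * (cappedMass x (β ^ t) + cappedMass y (β ^ t))) * (β ^ 2 * (β ^ t) ^ p) :=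
        mul_le_mul he.le hf (freqPow_nonneg _ _) ((by positivity : 0 ≤ ε * (k : ℝ)).trans he.le)
      _ = β ^ 2 * (η * ((β ^ t) ^ p * (cappedMass x (β ^ t) + cappedMass y (β ^ t)))) := by ring
      _ ≤ _ := by
        gcongr
        exact rpow_mul_cappedMass_add_le hp0 hp2 hk hβt x y fun _ => h1

/-- Two vectors that dominate each other in the sense of `CountDominated` have nearly the same
trimmed moments. -/
theorem abs_trimmedMoment_sub_le {k L : ℕ} {p β η ε : ℝ} (hp0 : 0 ≤ p) (hp2 : p ≤ 2)
    (hk : 2 * k ≤ n) (hβ : 1 < β) (hη : 0 ≤ η) (hε0 : 0 < ε) (hε1 : ε < 1)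
    (hβε : β ^ 6 ≤ 1 + ε / 10) (hηε : (L + 1) * (β ^ 2 * η) ≤ ε / 100) {x y : Fin n → ℤ}
    (hxy : CountDominated β η L x y) (hyx : CountDominated β η L y x)
    (hx : ∀ i, (topAbs x i : ℝ) ≤ β ^ L) (hy : ∀ i, (topAbs y i : ℝ) ≤ β ^ L) :
    |trimmedMoment y k p - trimmedMoment x k p| ≤ ε * (trimmedMoment x k p +
      (k : ℝ) * freqPow p (topAbs x ⌈(k : ℝ) - ε * (k : ℝ)⌉₊)) := by
  have hTx := trimmedMoment_nonneg x k p
  have hTy := trimmedMoment_nonneg y k p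
  have c1 := trimmedMoment_le hp0 hp2 hk hβ hη hxy hy
  have c2 := trimmedMoment_le hp0 hp2 hk hβ hη hyx hx
  have hs1 := comparisonScale_nonneg k p x y
  have hs2 := comparisonScale_nonneg k p y x
  have hη1 : β ^ 2 * η ≤ ε / 100 := by
    have : 0 ≤ (L : ℝ) * (β ^ 2 * η) := by positivity
    linarith
  have hA : (k : ℝ) * freqPow p (topAbs x k) ≤
      k * freqPow p (topAbs x ⌈(k : ℝ) - ε * (k : ℝ)⌉₊) := by
    gcongr
    refine freqPow_mono hp0 (topAbs_anti x (Nat.ceil_le.2 ?_))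
    nlinarith [Nat.cast_nonneg (α := ℝ) k]
  have hA0 : 0 ≤ (k : ℝ) * freqPow p (topAbs x k) :=
    mul_nonneg (by positivity) (freqPow_nonneg _ _)
  have hB0 : 0 ≤ (k : ℝ) * freqPow p (topAbs y k) :=
    mul_nonneg (by positivity) (freqPow_nonneg _ _)
  -- The permitted error involves only `x`, so the rank-`k` term of `y` is traded for quantities of
  -- `x` and the two moments.
  have hB : (k : ℝ) * freqPow p (topAbs y k) ≤
      2 * (k * freqPow p (topAbs x ⌈(k : ℝ) - ε * (k : ℝ)⌉₊)) +
        trimmedMoment x k p + trimmedMoment y k p := by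
    rcases Nat.eq_zero_or_pos k with h0 | h0
    · simp only [h0, Nat.cast_zero, zero_mul, mul_zero, zero_add] at *
      linarith
    rcases freqPow_topAbs_le hp0 hp2 hk hβ hη hε0 hε1 h0 hxy hy with h | h
    · have : β ^ 6 * (k * freqPow p (topAbs x ⌈(k : ℝ) - ε * (k : ℝ)⌉₊)) ≤
          2 * (k * freqPow p (topAbs x ⌈(k : ℝ) - ε * (k : ℝ)⌉₊)) := by
        refine mul_le_mul_of_nonneg_right (by linarith) (hA0.trans hA)
      linarith
    · have h' : ε * (k * freqPow p (topAbs y k)) ≤ ε * (comparisonScale k p x y / 100) := by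
        calc _ ≤ β ^ 2 * η * comparisonScale k p x y := by rw [mul_assoc]; exact h
          _ ≤ ε / 100 * comparisonScale k p x y := by gcongr
          _ = _ := by ring
      have h'' := le_of_mul_le_mul_left h' hε0
      unfold comparisonScale at h''
      linarith
  have d1 : (L + 1) * (β ^ 2 * (η * comparisonScale k p x y)) ≤
      ε / 100 * comparisonScale k p x y := by
    calc _ = (L + 1) * (β ^ 2 * η) * comparisonScale k p x y := by ring
      _ ≤ _ := by gcongr
  have d2 : (L + 1) * (β ^ 2 * (η * comparisonScale k p y x)) ≤
      ε / 100 * comparisonScale k p y x := by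
    calc _ = (L + 1) * (β ^ 2 * η) * comparisonScale k p y x := by ring
      _ ≤ _ := by gcongr
  have e1 : β ^ 6 * trimmedMoment x k p ≤ (1 + ε / 10) * trimmedMoment x k p := by gcongr
  have e2 : β ^ 6 * trimmedMoment y k p ≤ (1 + ε / 10) * trimmedMoment y k p := by gcongr
  unfold comparisonScale at c1 c2 d1 d2
  generalize (k : ℝ) * freqPow p (topAbs x k) = Ak at *
  generalize (k : ℝ) * freqPow p (topAbs y k) = Bk at *
  generalize (k : ℝ) * freqPow p (topAbs x ⌈(k : ℝ) - ε * (k : ℝ)⌉₊) = A at *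
  generalize trimmedMoment x k p = X at *
  generalize trimmedMoment y k p = Y at *
  have f1 : Y - X ≤ ε * (X / 10 + (4 * X + 4 * Y + 7 * A) / 100) := by
    have : ε * (X + Y + Ak + 3 * Bk) ≤ ε * (4 * X + 4 * Y + 7 * A) :=
      mul_le_mul_of_nonneg_left (by linarith) hε0.le
    linarith
  have f2 : X - Y ≤ ε * (Y / 10 + (4 * X + 4 * Y + 7 * A) / 100) := by
    have : ε * (Y + X + Bk + 3 * Ak) ≤ ε * (4 * X + 4 * Y + 7 * A) :=
      mul_le_mul_of_nonneg_left (by linarith) hε0.le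
    linarith
  -- In `f1` the moment `Y` occurs on both sides with a small coefficient on the right. Solving with
  -- `ε < 1` removes it from the error bounds.
  have hY : Y ≤ 2 * X + A := by
    have h1 : ε * (X / 10 + (4 * X + 4 * Y + 7 * A) / 100) ≤
        1 * (X / 10 + (4 * X + 4 * Y + 7 * A) / 100) := by
      refine mul_le_mul_of_nonneg_right hε1.le ?_
      linarith
    linarith
  rw [abs_le]
  constructor
  · have : ε * (Y / 10 + (4 * X + 4 * Y + 7 * A) / 100) ≤ ε * (X + A) :=
      mul_le_mul_of_nonneg_left (by linarith) hε0.le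
    linarith
  · have : ε * (X / 10 + (4 * X + 4 * Y + 7 * A) / 100) ≤ ε * (X + A) :=
      mul_le_mul_of_nonneg_left (by linarith) hε0.le
    linarith

end comparison

/-! ### From row statistics to counting functions -/

section RowStatistics

variable {ι : Type*} [Fintype ι] [DecidableEq ι]

theorem rowProb_mem_Icc {q : ℝ} (h0 : 0 ≤ q) (h1 : q ≤ 1) (x : ι → ℤ) (v : ℝ) :
    rowProb q x v ∈ Set.Icc 0 1 := by
  have hP := probWeights_signWeight ι h0 h1
  constructor
  · rw [← prodExp_const hP 0]
    exact prodExp_mono hP fun ξ => by split_ifs <;> simp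
  · rw [← prodExp_const hP 1]
    exact prodExp_mono hP fun ξ => by split_ifs <;> simp

theorem cappedMass_le_card (x : ι → ℤ) (v : ℝ) : cappedMass x v ≤ Fintype.card ι := by
  calc cappedMass x v ≤ ∑ _i : ι, (1 : ℝ) := Finset.sum_le_sum fun _ _ => min_le_left _ _
    _ = _ := by simp

theorem countGe_le_cappedMass (x : ι → ℤ) {v u : ℝ} (hv : 0 < v) (hu : v ≤ u) :
    (countGe x u : ℝ) ≤ cappedMass x v := by
  have h := card_medium_le x hv one_pos le_rfl
  rw [one_pow, div_one, one_mul] at h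
  refine le_trans ?_ h
  unfold countGe
  exact_mod_cast Finset.card_le_card
    (Finset.monotone_filter_right _ fun i _ h => hu.trans h)

theorem cappedMass_div_le (x : ι → ℤ) {v β : ℝ} (hv : 0 < v) (hβ : 1 ≤ β) :
    cappedMass x (v / β) ≤ β ^ 2 * cappedMass x v := by
  unfold cappedMass
  rw [Finset.mul_sum]
  refine Finset.sum_le_sum fun i _ => ?_
  rw [mul_min_of_nonneg _ _ (by positivity)]
  refine min_le_min ?_ (le_of_eq ?_)
  · nlinarith
  · field_simp

/-- Similar row statistics at all sampling rates force similar numbers of large coordinates. -/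
theorem countGe_le_of_rowProb_le {J : ℕ} {v β a τ κ tol η : ℝ} {x y : ι → ℤ} (hv : 0 < v)
    (hβ : 1 < β) (ha0 : 0 ≤ a) (ha : β * a ≤ β - 1) (hτ0 : 0 < τ) (hτ1 : τ ≤ 1) (hκ0 : 0 < κ)
    (hκ : 2 * κ ≤ τ ^ 2) (hη : 0 ≤ η) (hJ : 2 * Fintype.card ι / κ < 2 ^ J)
    (herr : 2 * (4 * κ ^ 2 / τ ^ 4 + 2 * Real.exp (1 - a / τ)) + 2 * tol ≤ η * κ)
    (h : ∀ j < J, rowProb (1 / 2 ^ j) y v ≤ rowProb (1 / 2 ^ j) x v + 2 * tol) :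
    (countGe y (β * v) : ℝ) ≤ countGe x (v / β) + η * (cappedMass x v + cappedMass y v) := by
  have hx0 := cappedMass_nonneg x v
  have hy0 := cappedMass_nonneg y v
  have hxc := cappedMass_le_card x v
  have hyc := cappedMass_le_card y v
  set H := cappedMass x v + cappedMass y v with hH
  -- Counts are integers, so a total mass below `1` leaves `y` without coordinates above `β * v`,
  -- and no sampling rate is needed.
  rcases lt_or_ge H 1 with hlt | hge
  · have h1 := countGe_le_cappedMass y hv (show v ≤ β * v by nlinarith)
    have h2 : (countGe y (β * v) : ℝ) < 1 := by linarith
    have h3 : countGe y (β * v) = 0 := by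
      have : countGe y (β * v) < 1 := by exact_mod_cast h2
      omega
    rw [h3, Nat.cast_zero]
    positivity
  have hκ1 : κ ≤ 1 := by nlinarith
  -- This level puts `q * H` in `[κ, 2 * κ]`: small enough that collisions cost only order `κ ^ 2 /
  -- τ ^ 4`, large enough that an error `η * κ` in probability is at most `η * H` after division by
  -- `q`.
  obtain ⟨j, hj1, hj2⟩ := exists_nat_pow_near
    (show (1 : ℝ) ≤ H / κ by rw [le_div_iff₀ hκ0]; linarith) one_lt_two
  have hjJ : j < J := by
    have h1 : H / κ ≤ 2 * Fintype.card ι / κ := by gcongr; linarith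
    exact (pow_lt_pow_iff_right₀ (one_lt_two (α := ℝ))).1 (by linarith)
  set q : ℝ := 1 / 2 ^ j with hq
  have hq0 : 0 < q := by positivity
  have hq1 : q ≤ 1 := by
    rw [hq, div_le_one (by positivity)]
    exact one_le_pow₀ one_le_two
  have hqH1 : κ ≤ q * H := by
    rw [le_div_iff₀ hκ0] at hj1
    rw [hq, one_div, le_inv_mul_iff₀ (by positivity)]
    exact hj1
  have hqH2 : q * H ≤ 2 * κ := by
    rw [div_lt_iff₀ hκ0, pow_succ] at hj2
    rw [hq, one_div, inv_mul_le_iff₀ (by positivity)]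
    linarith
  have hE : rowError q τ a H ≤ 4 * κ ^ 2 / τ ^ 4 + 2 * Real.exp (1 - a / τ) := by
    unfold rowError
    gcongr ?_ + 2 * Real.exp ?_
    · calc q ^ 2 * (H / τ ^ 2) ^ 2 = (q * H) ^ 2 / τ ^ 4 := by field_simp
        _ ≤ (2 * κ) ^ 2 / τ ^ 4 := by gcongr
        _ = _ := by ring
    · have : q * H / τ ^ 2 ≤ 1 := by
        rw [div_le_one (by positivity)]
        linarith
      linarith
  have ha1 : a ≤ β - 1 := by nlinarith
  have b1 := (rowProb_bounds hq0.le hq1 y hv hτ0 hτ1 (show _ ≤ H by linarith)).2 (β * v)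
    (by nlinarith) ha0
  have b2 := (rowProb_bounds (a := a) hq0.le hq1 x hv hτ0 hτ1 (show _ ≤ H by linarith)).1 (v / β)
    (by
      have : v / β = v - (β - 1) * v / β := by field_simp; ring
      rw [this]
      have : a * v ≤ (β - 1) * v / β := by
        rw [le_div_iff₀ (by positivity)]
        nlinarith
      linarith) (by nlinarith)
  have b3 := h j hjJ
  have b4 : η * κ ≤ η * (q * H) := by gcongr
  have b5 : q * countGe y (β * v) ≤ q * (countGe x (v / β) + η * H) := by
    have : q * (countGe x (v / β) + η * H) = q * countGe x (v / β) + η * (q * H) := by ring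
    rw [this]
    linarith
  exact le_of_mul_le_mul_left b5 hq0

end RowStatistics

/-! ### Consistency of a sketch with a vector -/

section search

variable {n J M : ℕ}

/-- The rows of the sketch at sampling level `j` have density `2 ^ (-j)`. -/
noncomputable def levelWeight (n J M : ℕ) (r : Fin J × Fin M) (ξ : Fin n → SignType) : ℝ :=
  ∏ i, signWeight (1 / 2 ^ (r.1 : ℕ)) (ξ i)

theorem levelRate_mem (j : ℕ) : (0 : ℝ) ≤ 1 / 2 ^ j ∧ (1 : ℝ) / 2 ^ j ≤ 1 :=
  ⟨by positivity, by
    rw [div_le_one (by positivity)]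
    exact one_le_pow₀ one_le_two⟩

theorem probWeights_levelWeight (n J M : ℕ) : ProbWeights (levelWeight n J M) :=
  ProbWeights.prod (fun (r : Fin J × Fin M) (_ : Fin n) => signWeight (1 / 2 ^ (r.1 : ℕ)))
    fun r => probWeights_signWeight (Fin n) (levelRate_mem r.1).1 (levelRate_mem r.1).2

/-- How much the number of large entries at level `j` of a sketch `Z` exceeds its expectation
for the vector `y`. -/
noncomputable def excess (β : ℝ) (Z : Fin J × Fin M → ℤ) (y : Fin n → ℤ) (j : Fin J) (t : ℕ) : ℝ :=
  ∑ r : Fin M, ((if β ^ t / β ≤ |(Z (j, r) : ℝ)| then 1 else 0) -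
    rowProb (1 / 2 ^ (j : ℕ)) y (β ^ t / β))

/-- The sketch `Z` looks like a typical sketch of `y`. -/
def Consistent (β tol : ℝ) (L : ℕ) (Z : Fin J × Fin M → ℤ) (y : Fin n → ℤ) : Prop :=
  ∀ (j : Fin J), ∀ t < L, |excess β Z y j t| < tol * M

-- Chebyshev over the `M` rows of a level bounds each deviation by `1 / (tol ^ 2 * M)`. A union
-- bound over `J` levels and `L` thresholds finishes.
open Classical in
theorem prob_not_consistent_le (β : ℝ) {tol : ℝ} (htol : 0 < tol) (hM : 0 < M) (L : ℕ)
    (x : Fin n → ℤ) :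
    prodExp (levelWeight n J M) (fun ω =>
      if ¬ Consistent β tol L (fun r => rowVal (ω r) x) x then 1 else 0) ≤
      J * L / (tol ^ 2 * M) := by
  have hP := probWeights_levelWeight n J M
  have hM' : (0 : ℝ) < M := by exact_mod_cast hM
  have hpt : ∀ ω : Fin J × Fin M → Fin n → SignType,
      (if ¬ Consistent β tol L (fun r => rowVal (ω r) x) x then (1 : ℝ) else 0) ≤
      ∑ j : Fin J, ∑ t ∈ Finset.range L,
        if tol * M ≤ |excess β (fun r => rowVal (ω r) x) x j t| then 1 else 0 := by
    intro ω
    have hnn : ∀ j : Fin J, ∀ t ∈ Finset.range L,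
        (0 : ℝ) ≤ if tol * M ≤ |excess β (fun r => rowVal (ω r) x) x j t| then 1 else 0 :=
      fun j t _ => by split_ifs <;> simp
    split_ifs with h
    · exact Finset.sum_nonneg fun j _ => Finset.sum_nonneg (hnn j)
    · unfold Consistent at h
      push Not at h
      obtain ⟨j, t, ht, hjt⟩ := h
      refine le_trans ?_ (Finset.single_le_sum (fun j _ => Finset.sum_nonneg (hnn j))
        (Finset.mem_univ j))
      refine le_trans ?_ (Finset.single_le_sum (hnn j) (Finset.mem_range.2 ht))
      rw [if_pos hjt]
  refine (prodExp_mono hP hpt).trans ?_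
  rw [prodExp_sum]
  have hone : ∀ j : Fin J, ∀ t : ℕ, prodExp (levelWeight n J M) (fun ω =>
      if tol * M ≤ |excess β (fun r => rowVal (ω r) x) x j t| then 1 else 0) ≤
      1 / (tol ^ 2 * M) := by
    intro j t
    have hj := levelRate_mem (j : ℕ)
    have hr := rowProb_mem_Icc hj.1 hj.2 x (β ^ t / β)
    let S : Finset (Fin J × Fin M) := Finset.univ.map ⟨Prod.mk j, Prod.mk_right_injective j⟩
    let g : Fin J × Fin M → (Fin n → SignType) → ℝ := fun _ ξ =>
      (if β ^ t / β ≤ |(rowVal ξ x : ℝ)| then 1 else 0) - rowProb (1 / 2 ^ (j : ℕ)) x (β ^ t / β)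
    have hch := prodExp_chebyshev hP S g
      (fun r hr => by
        obtain ⟨r', -, rfl⟩ := Finset.mem_map.1 hr
        have h1 : ∑ ξ, levelWeight n J M (j, r') ξ *
            (if β ^ t / β ≤ |(rowVal ξ x : ℝ)| then 1 else 0) =
            rowProb (1 / 2 ^ (j : ℕ)) x (β ^ t / β) := rfl
        show ∑ ξ, levelWeight n J M (j, r') ξ * g (j, r') ξ = 0
        simp only [g, mul_sub, Finset.sum_sub_distrib]
        rw [h1, ← Finset.sum_mul, hP.sum_eq]
        ring)
      (fun r _ ξ => by
        have h1 := hr.1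
        have h2 := hr.2
        simp only [g]
        rw [abs_le]
        split_ifs <;> constructor <;> linarith)
      (show 0 < tol * M by positivity)
    have hc : S.card = M := by simp [S]
    simp only [S, Finset.sum_map] at hch
    rw [show (Finset.univ.map ⟨Prod.mk j, Prod.mk_right_injective j⟩ :
      Finset (Fin J × Fin M)).card = M from hc] at hch
    refine le_trans (le_of_eq ?_) (hch.trans (le_of_eq ?_))
    · rfl
    · field_simp
  calc _ ≤ ∑ j : Fin J, ∑ t ∈ Finset.range L, 1 / (tol ^ 2 * M) := by
        refine Finset.sum_le_sum fun j _ => ?_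
        rw [prodExp_sum]
        exact Finset.sum_le_sum fun t _ => hone j t
    _ = _ := by
        simp
        ring

/-- The same observed frequency is within `tol` of both probabilities. The rows that produced `Z`
play no role. -/
theorem rowProb_le_of_consistent {β tol : ℝ} {L : ℕ} (hM : 0 < M) {Z : Fin J × Fin M → ℤ}
    {x y : Fin n → ℤ} (hx : Consistent β tol L Z x) (hy : Consistent β tol L Z y) {j t : ℕ}
    (hj : j < J) (ht : t < L) :
    rowProb (1 / 2 ^ j) y (β ^ t / β) ≤ rowProb (1 / 2 ^ j) x (β ^ t / β) + 2 * tol := by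
  have hM' : (0 : ℝ) < M := by exact_mod_cast hM
  have h1 := abs_lt.1 (hx ⟨j, hj⟩ t ht)
  have h2 := abs_lt.1 (hy ⟨j, hj⟩ t ht)
  unfold excess at h1 h2
  rw [Finset.sum_sub_distrib, Finset.sum_const, Finset.card_univ, Fintype.card_fin,
    nsmul_eq_mul] at h1 h2
  have h3 : (M : ℝ) * rowProb (1 / 2 ^ j) y (β ^ t / β) ≤
      M * (rowProb (1 / 2 ^ j) x (β ^ t / β) + 2 * tol) := by
    simp only at h1 h2
    linarith
  exact le_of_mul_le_mul_left h3 hM'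

/-- The statistics are compared at `v = β ^ t / β`, which lies midway on the grid, so the blur on
either side gives `β ^ t` and `β ^ t / β ^ 2`. Moving the capped masses from `v` to `β ^ t` costs
the factor `β ^ 2` in `η`. -/
theorem countDominated_of_consistent {L : ℕ} {β a τ κ tol η : ℝ} (hM : 0 < M)
    (hβ : 1 < β) (ha0 : 0 ≤ a) (ha : β * a ≤ β - 1) (hτ0 : 0 < τ) (hτ1 : τ ≤ 1) (hκ0 : 0 < κ)
    (hκ : 2 * κ ≤ τ ^ 2) (hη : 0 ≤ η) (hJ : 2 * n / κ < 2 ^ J)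
    (herr : 2 * (4 * κ ^ 2 / τ ^ 4 + 2 * Real.exp (1 - a / τ)) + 2 * tol ≤ η * κ)
    {Z : Fin J × Fin M → ℤ} {x y : Fin n → ℤ} (hx : Consistent β tol (L + 1) Z x)
    (hy : Consistent β tol (L + 1) Z y) :
    CountDominated β (β ^ 2 * η) L x y := by
  intro t ht
  have hβt : 0 < β ^ t := by positivity
  have h := countGe_le_of_rowProb_le (J := J) (v := β ^ t / β) (by positivity) hβ ha0 ha hτ0 hτ1
    hκ0 hκ hη (by rwa [Fintype.card_fin]) herr fun j hj =>
      rowProb_le_of_consistent hM hx hy hj (Nat.lt_succ_of_le ht)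
  rw [mul_div_cancel₀ _ (by positivity), div_div, ← sq] at h
  have h1 := cappedMass_div_le x hβt hβ.le
  have h2 := cappedMass_div_le y hβt hβ.le
  have h3 : η * (cappedMass x (β ^ t / β) + cappedMass y (β ^ t / β)) ≤
      η * (β ^ 2 * cappedMass x (β ^ t) + β ^ 2 * cappedMass y (β ^ t)) := by gcongr
  calc _ ≤ _ := h
    _ ≤ countGe x (β ^ t / β ^ 2) +
        η * (β ^ 2 * cappedMass x (β ^ t) + β ^ 2 * cappedMass y (β ^ t)) := by gcongr
    _ = _ := by ring

end search

/-! ### The search decoder and its short seed -/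

open Classical in
/-- The sketch that stores the rows `σ ω`, and whose decoder outputs the trimmed moment of any
vector in the box `[-m, m]^n` that is consistent with the stored entries. -/
noncomputable def searchSketch {n J M s : ℕ} (β tol : ℝ) (L m k : ℕ) (p : ℝ)
    (σ : (Fin s → Bool) → Fin J × Fin M → Fin n → SignType) : LinearSketch n where
  seedBits := s
  rows := J * M
  matrix ω := Matrix.of fun r i => ((σ ω (finProdFinEquiv.symm r) i : SignType) : ℤ)
  decode _ z :=
    if h : ∃ y : Fin n → ℤ, (∀ i, |y i| ≤ (m : ℤ)) ∧
      Consistent β tol L (fun r => z (finProdFinEquiv r)) y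
    then trimmedMoment h.choose k p else 0

section searchSketch

variable {n J M s : ℕ} {β tol : ℝ} {L m k : ℕ} {p : ℝ}
  {σ : (Fin s → Bool) → Fin J × Fin M → Fin n → SignType}

theorem searchSketch_mulVec (ω : Fin s → Bool) (x : Fin n → ℤ) (r : Fin (J * M)) :
    ((searchSketch β tol L m k p σ).matrix ω).mulVec x r =
      rowVal (σ ω (finProdFinEquiv.symm r)) x := rfl

theorem searchSketch_usesAtMostBits {w : ℕ} (hw : n * m < 2 ^ w) :
    (searchSketch β tol L m k p σ).UsesAtMostBits m ((s + J * M * (w + 1) : ℕ) : ℝ) := by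
  refine ⟨w, fun ω x hx r => ?_, le_rfl⟩
  have h : |rowVal (σ ω (finProdFinEquiv.symm r)) x| ≤ n * m := by
    calc _ ≤ ∑ i, |((σ ω (finProdFinEquiv.symm r) i : SignType) : ℤ) * x i| :=
          Finset.abs_sum_le_sum_abs _ _
      _ ≤ ∑ _i : Fin n, (m : ℤ) := by
          refine Finset.sum_le_sum fun i _ => ?_
          rw [abs_mul]
          have h1 : |((σ ω (finProdFinEquiv.symm r) i : SignType) : ℤ)| ≤ 1 := by
            cases σ ω (finProdFinEquiv.symm r) i <;> simp
          calc _ ≤ 1 * |x i| := by gcongr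
            _ ≤ _ := by rw [one_mul]; exact hx i
      _ = _ := by simp
  have hw' : (n : ℤ) * m < 2 ^ w := by exact_mod_cast hw
  exact h.trans_lt hw'

/-- The input itself passes the test, so the search succeeds. Whichever `y` is found, only its
consistency with the same entries is needed later. -/
theorem searchSketch_estimate (ω : Fin s → Bool) {x : Fin n → ℤ} (hx : ∀ i, |x i| ≤ (m : ℤ))
    (hc : Consistent β tol L (fun r => rowVal (σ ω r) x) x) :
    ∃ y : Fin n → ℤ, (∀ i, |y i| ≤ (m : ℤ)) ∧
      Consistent β tol L (fun r => rowVal (σ ω r) x) y ∧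
      (searchSketch β tol L m k p σ).estimate ω x = trimmedMoment y k p := by
  have e : (fun r : Fin J × Fin M =>
      ((searchSketch β tol L m k p σ).matrix ω).mulVec x (finProdFinEquiv r)) =
      fun r => rowVal (σ ω r) x := by
    funext r
    rw [searchSketch_mulVec, Equiv.symm_apply_apply]
  have h : ∃ y : Fin n → ℤ, (∀ i, |y i| ≤ (m : ℤ)) ∧ Consistent β tol L (fun r : Fin J × Fin M =>
      ((searchSketch β tol L m k p σ).matrix ω).mulVec x (finProdFinEquiv r)) y :=
    ⟨x, hx, by rw [e]; exact hc⟩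
  refine ⟨h.choose, h.choose_spec.1, ?_, ?_⟩
  · exact Eq.mp (congrArg (fun Z => Consistent β tol L Z h.choose) e) h.choose_spec.2
  · unfold LinearSketch.estimate
    exact dif_pos h

end searchSketch

open Classical in
/-- A few seed bits suffice to make the random rows consistent with every vector of the box. -/
theorem exists_consistent_rows {n J M s L m c : ℕ} (β : ℝ) {tol : ℝ} (htol : 0 < tol) (hM : 0 < M)
    (hfail : (J : ℝ) * L / (tol ^ 2 * M) ≤ 1 / 4 ^ c) (hs : (2 * m + 1) ^ n < 2 ^ 2 ^ s) :
    ∃ σ : (Fin s → Bool) → Fin J × Fin M → Fin n → SignType,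
      ∀ x : Fin n → ℤ, (∀ i, |x i| ≤ (m : ℤ)) →
        c * (Finset.univ.filter fun ω =>
          ¬ Consistent β tol L (fun r => rowVal (σ ω r) x) x).card < 2 ^ s := by
  have hP := probWeights_levelWeight n J M
  have hcard : Fintype.card (Fin s → Bool) = 2 ^ s := by simp
  obtain ⟨σ, hσ⟩ := exists_family_few_bad (ι := Fin s → Bool)
    (X := Fin n → ↥(Finset.Icc (-(m : ℤ)) m))
    (fun ω : Fin J × Fin M → Fin n → SignType => ∏ r, levelWeight n J M r (ω r))
    (fun ω => Finset.prod_nonneg fun r _ => hP.nonneg r _)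
    (by simpa [prodExp] using prodExp_one hP)
    (fun x ω => ¬ Consistent β tol L (fun r => rowVal (ω r) fun i => (x i : ℤ)) fun i => (x i : ℤ))
    c (fun x => by
      have := (prob_not_consistent_le β htol hM L fun i => (x i : ℤ)).trans hfail
      refine le_trans (le_of_eq (Finset.sum_congr rfl fun ω _ => ?_)) this
      congr)
    (by
      rw [hcard, Fintype.card_fun, Fintype.card_coe, Int.card_Icc, Fintype.card_fin]
      convert hs using 2
      omega)
  refine ⟨σ, fun x hx => ?_⟩
  rw [hcard] at hσ
  convert hσ fun i => ⟨x i, Finset.mem_Icc.2 (abs_le.1 (hx i))⟩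

theorem one_sub_le_probWithin {n : ℕ} (A : LinearSketch n) {x : Fin n → ℤ} {v err δ : ℝ} {c : ℕ}
    (hδ : 1 ≤ c * δ) (good : (Fin A.seedBits → Bool) → Prop) [DecidablePred good]
    (hgood : ∀ ω, good ω → |A.estimate ω x - v| ≤ err)
    (hbad : c * (Finset.univ.filter fun ω => ¬ good ω).card < 2 ^ A.seedBits) :
    1 - δ ≤ A.probWithin x v err := by
  classical
  unfold LinearSketch.probWithin
  rw [le_div_iff₀ (by positivity)]
  refine le_trans ?_ (Nat.cast_le.2 (Finset.card_le_card
    (Finset.monotone_filter_right Finset.univ fun ω _ => hgood ω)))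
  have h2 := Finset.card_filter_add_card_filter_not (s := Finset.univ)
    (fun ω : Fin A.seedBits → Bool => good ω)
  rw [Finset.card_univ, Fintype.card_fun, Fintype.card_bool, Fintype.card_fin] at h2
  have h2' : ((Finset.univ.filter fun ω => good ω).card : ℝ) +
      ((Finset.univ.filter fun ω => ¬ good ω).card : ℝ) = 2 ^ A.seedBits := by
    exact_mod_cast h2
  have h3 : (c : ℝ) * ((Finset.univ.filter fun ω => ¬ good ω).card : ℝ) < 2 ^ A.seedBits := by
    exact_mod_cast hbad
  have hc : 0 < (c : ℝ) := by
    rcases Nat.eq_zero_or_pos c with h | h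
    · simp [h] at hδ
      linarith
    · exact_mod_cast h
  have h4 : ((Finset.univ.filter fun ω => ¬ good ω).card : ℝ) ≤ δ * 2 ^ A.seedBits := by
    have h5 : 1 * (2 : ℝ) ^ A.seedBits ≤ c * δ * 2 ^ A.seedBits := by gcongr
    have h6 : (c : ℝ) * ((Finset.univ.filter fun ω => ¬ good ω).card : ℝ) ≤
        c * (δ * 2 ^ A.seedBits) := by
      rw [← mul_assoc]
      linarith
    exact le_of_mul_le_mul_left h6 hc
  have h7 : (1 - δ) * (2 : ℝ) ^ A.seedBits = 2 ^ A.seedBits - δ * 2 ^ A.seedBits := by ring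
  rw [h7]
  linarith

/-! ### Choice of parameters -/

/-- The accuracy required of the sampled frequencies is attained with polynomial parameters. -/
theorem error_budget {R T D κ tol : ℝ} (hD : 1 ≤ D) (hDR : D ≤ R) (hR : 10 ^ 20 ≤ R)
    (hT : T = 200 * D * R) (hκ : κ = 1 / (32 * R * T ^ 4)) (htol : tol = 1 / (128 * R ^ 2 * T ^ 4)) :
    2 * (4 * κ ^ 2 / (1 / T) ^ 4 + 2 * Real.exp (1 - 1 / (200 * D) / (1 / T))) + 2 * tol ≤
      1 / R * κ := by
  have hR0 : 0 < R := by linarith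
  have hD0 : 0 < D := by linarith
  have hT0 : 0 < T := by rw [hT]; positivity
  -- In units of `1 / (128 * R ^ 2 * T ^ 4)` the budget on the right is `4`. Collisions take one
  -- unit, the exponential tail at most one, and the tolerance two.
  have e1 : 1 / (200 * D) / (1 / T) = R := by rw [hT]; field_simp
  have e2 : 2 * (4 * κ ^ 2 / (1 / T) ^ 4) = 1 / (128 * R ^ 2 * T ^ 4) := by
    rw [hκ]; field_simp; norm_num
  have e3 : 1 / R * κ = 4 * (1 / (128 * R ^ 2 * T ^ 4)) := by
    rw [hκ]; field_simp; norm_num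
  have hT4 : T ^ 4 ≤ 200 ^ 4 * R ^ 8 := by
    calc T ^ 4 = 200 ^ 4 * (D ^ 4 * R ^ 4) := by rw [hT]; ring
      _ ≤ 200 ^ 4 * (R ^ 4 * R ^ 4) := by gcongr
      _ = _ := by ring
  -- Since `T ^ 4` is at most of order `R ^ 8`, the tail must beat a polynomial of degree `10`. The
  -- Taylor term of degree `11` does so, with `39916800 = 11!`, and `10 ^ 20` absorbs all constants.
  have hexp : R ^ 11 / 39916800 ≤ Real.exp R := by
    have := Real.pow_div_factorial_le_exp R hR0.le 11
    norm_num [Nat.factorial] at this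
    exact this
  have he : 4 * Real.exp (1 - R) ≤ 1 / (128 * R ^ 2 * T ^ 4) := by
    rw [Real.exp_sub, le_div_iff₀ (by positivity), ← mul_div_assoc, div_mul_eq_mul_div,
      div_le_one (Real.exp_pos _)]
    refine le_trans ?_ hexp
    have h3 : Real.exp 1 ≤ 3 := by linarith [Real.exp_one_lt_d9]
    calc 4 * Real.exp 1 * (128 * R ^ 2 * T ^ 4) ≤ 4 * 3 * (128 * R ^ 2 * (200 ^ 4 * R ^ 8)) := by
          gcongr
      _ = (4 * 3 * 128 * 200 ^ 4 * 39916800) * R ^ 10 / 39916800 := by ring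
      _ ≤ R * R ^ 10 / 39916800 := by
          gcongr
          refine le_trans ?_ hR
          norm_num
      _ = _ := by ring
  rw [mul_add, e1, e2, e3, htol]
  linarith

/-- The scale `D` is at least `1 / ε` and `log₂ n`, up to a constant not larger. -/
theorem exists_size_parameter {n : ℕ} {ε : ℝ} (hn : 2 ≤ n) (h0 : 0 < ε) (h1 : ε < 1) :
    ∃ D : ℕ, 1 ≤ D ∧ 1 / (D : ℝ) ≤ ε ∧ n ≤ 2 ^ D ∧ (D : ℝ) ≤ 4 * (Real.log n / ε) := by
  have hl2 := Real.log_two_gt_d9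
  have hn' : (2 : ℝ) ≤ n := by exact_mod_cast hn
  have hln : Real.log 2 ≤ Real.log n := Real.log_le_log (by norm_num) hn'
  have hΛ : Real.log n ≤ Real.log n / ε := by
    rw [le_div_iff₀ h0]
    nlinarith
  have hε : 1 ≤ 2 * (Real.log n / ε) * ε := by
    rw [mul_assoc, div_mul_cancel₀ _ h0.ne']
    linarith
  have hD := Nat.le_ceil (2 * (Real.log n / ε))
  have hD' := Nat.ceil_lt_add_one (show 0 ≤ 2 * (Real.log n / ε) by linarith)
  -- The factor `2` serves twice through `2 * log 2 ≥ 1`: it gives `1 / D ≤ ε` even for `n = 2`, and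
  -- it turns the natural logarithm into a bound on the binary one.
  refine ⟨⌈2 * (Real.log n / ε)⌉₊, Nat.one_le_ceil_iff.2 (by linarith), ?_, ?_, by linarith⟩
  · rw [div_le_iff₀ (by linarith)]
    nlinarith
  · have : (n : ℝ) ≤ 2 ^ ⌈2 * (Real.log n / ε)⌉₊ := by
      rw [← Real.log_le_log_iff (by linarith) (by positivity), Real.log_pow]
      nlinarith
    exact_mod_cast this

theorem gridRatio_pow_le {u : ℝ} (h0 : 0 < u) (h1 : u ≤ 1 / 100) :
    (1 + u) ^ 4 ≤ 2 ∧ (1 + u) ^ 6 ≤ 1 + 10 * u := by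
  have h2 : (1 + u) ^ 2 ≤ 1 + 2.01 * u := by nlinarith
  have h4 : (1 + u) ^ 4 ≤ 1 + 5 * u := by
    calc (1 + u) ^ 4 = ((1 + u) ^ 2) ^ 2 := by ring
      _ ≤ (1 + 2.01 * u) ^ 2 := by gcongr
      _ ≤ _ := by nlinarith
  refine ⟨by linarith, ?_⟩
  calc (1 + u) ^ 6 = (1 + u) ^ 4 * (1 + u) ^ 2 := by ring
    _ ≤ (1 + 5 * u) * (1 + 2.01 * u) := by gcongr
    _ ≤ _ := by nlinarith

theorem two_le_gridRatio_pow {D : ℕ} (hD : 1 ≤ D) : (2 : ℝ) ≤ (1 + 1 / (100 * D)) ^ (100 * D) := by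
  have hD' : (1 : ℝ) ≤ D := by exact_mod_cast hD
  have h0 : (0 : ℝ) < 1 / (100 * D) := by positivity
  have := one_add_mul_le_pow (show (-2 : ℝ) ≤ 1 / (100 * D) by linarith) (100 * D)
  refine le_trans (le_of_eq ?_) this
  push_cast
  field_simp
  norm_num

theorem two_mul_rate_le {R T : ℝ} (hR : 1 ≤ R) (hT : 1 ≤ T) :
    2 * (1 / (32 * R * T ^ 4)) ≤ (1 / T) ^ 2 := by
  have hT2 : 1 ≤ T ^ 2 := one_le_pow₀ hT
  have h1 : 1 ≤ 16 * R * T ^ 2 := by nlinarith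
  rw [one_div_pow, mul_one_div, div_le_div_iff₀ (by positivity) (by positivity)]
  calc 2 * T ^ 2 ≤ 2 * T ^ 2 * (16 * R * T ^ 2) := le_mul_of_one_le_right (by positivity) h1
    _ = _ := by ring

/-- The sketch with all parameters chosen as monomials in the size parameter `D`. -/
theorem exists_trimmedMoment_sketch {n k d D K : ℕ} {ε p δ : ℝ} (hn : 2 ≤ n) (hk : 2 * k ≤ n)
    (hε0 : 0 < ε) (hε1 : ε < 1) (hp0 : 0 ≤ p) (hp2 : p ≤ 2) (hδ : 1 ≤ K * δ) (hD1 : 1 ≤ D)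
    (hDε : 1 / (D : ℝ) ≤ ε) (hDn : n ≤ 2 ^ D) {R T J M s w : ℕ} (hR : R = 10 ^ 20 * (d + 1) * D ^ 3)
    (hT : T = 200 * D * R) (hJ : D + 64 * R * T ^ 4 ≤ J)
    (hM : M = 4 ^ K * J * (100 * (d + 1) * D ^ 2) * (128 * R ^ 2 * T ^ 4) ^ 2)
    (hs : s = (d + 4) * D) (hw : w = (d + 2) * D) :
    ∃ A : LinearSketch n, A.UsesAtMostBits (n ^ d) ((s + J * M * (w + 1) : ℕ) : ℝ) ∧
      ∀ x : Fin n → ℤ, (∀ i, |x i| ≤ ((n ^ d : ℕ) : ℤ)) →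
        1 - δ ≤ A.probWithin x (trimmedMoment x k p) (ε * (trimmedMoment x k p +
          (k : ℝ) * freqPow p (topAbs x ⌈(k : ℝ) - ε * (k : ℝ)⌉₊))) := by
  classical
  have hsD : D * d + 2 + D ≤ s := by
    have : (d + 4) * D = D * d + D + 3 * D := by ring
    rw [hs]
    linarith only [this, hD1]
  have hwD : D + D * d < w := by
    have : (d + 2) * D = D * d + D + D := by ring
    rw [hw]
    linarith only [this, hD1]
  -- With `β = 1 + 1 / (100 * D)`, every `100 * D` steps of the grid at least double the threshold,
  -- so `L` steps reach `2 ^ (D * d) ≥ n ^ d`.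
  set L := 100 * D * (D * d) with hL
  have hm : n ^ d ≤ 2 ^ (D * d) := by
    rw [pow_mul]
    exact Nat.pow_le_pow_left hDn d
  have hDr : (1 : ℝ) ≤ D := by exact_mod_cast hD1
  have hR' : (R : ℝ) = 10 ^ 20 * (d + 1) * D ^ 3 := by rw [hR]; push_cast; ring
  have hd0 : (0 : ℝ) ≤ d := by positivity
  have hDR : 10 ^ 20 * D ≤ (R : ℝ) := by
    have h1 : (D : ℝ) ≤ D ^ 3 := le_self_pow₀ hDr (by norm_num)
    rw [hR']
    nlinarith only [h1, hd0, hDr]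
  have hT' : (T : ℝ) = 200 * D * R := by rw [hT]; push_cast; ring
  have hR0 : (0 : ℝ) < R := by linarith only [hDR, hDr]
  have hT0 : (0 : ℝ) < T := by rw [hT']; positivity
  have hT1 : (1 : ℝ) ≤ T := by rw [hT']; nlinarith only [hDR, hDr]
  have hJ0 : 0 < J := lt_of_lt_of_le (by positivity) hJ
  have hRn : 0 < R := by exact_mod_cast hR0
  have hTn : 0 < T := by exact_mod_cast hT0
  have hM0 : 0 < M := by rw [hM]; positivity
  set β : ℝ := 1 + 1 / (100 * D) with hβ
  set κ : ℝ := 1 / (32 * R * T ^ 4) with hκ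
  set tol : ℝ := 1 / (128 * R ^ 2 * T ^ 4) with htol
  have hκ0 : 0 < κ := by positivity
  have htol0 : 0 < tol := by positivity
  have hu0 : (0 : ℝ) < 1 / (100 * D) := by positivity
  have hu1 : (1 : ℝ) / (100 * D) ≤ 1 / 100 := by
    rw [div_le_div_iff₀ (by positivity) (by norm_num)]
    linarith only [hDr]
  have huε : (1 : ℝ) / (100 * D) ≤ ε / 100 := by
    have : (1 : ℝ) / (100 * D) = 1 / D / 100 := by field_simp
    rw [this]
    linarith only [hDε]
  have hβ1 : 1 < β := lt_add_of_pos_right 1 hu0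
  have hβ4 : β ^ 4 ≤ 2 := (gridRatio_pow_le hu0 hu1).1
  have hβ6 : β ^ 6 ≤ 1 + ε / 10 := by
    linarith only [(gridRatio_pow_le hu0 hu1).2, huε]
  have hL1 : (L : ℝ) + 1 ≤ 100 * (d + 1) * D ^ 2 := by
    rw [hL]
    push_cast
    nlinarith only [hDr, hd0]
  -- This dictates `R`: two of its factors `D` pay for the number of scales and the third for `1 /
  -- ε`.
  have hηε : ((L : ℝ) + 1) * (β ^ 2 * (β ^ 2 * (1 / R))) ≤ ε / 100 := by
    calc ((L : ℝ) + 1) * (β ^ 2 * (β ^ 2 * (1 / (R : ℝ)))) = ((L : ℝ) + 1) * β ^ 4 / R := by ring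
      _ ≤ 100 * ((d : ℝ) + 1) * (D : ℝ) ^ 2 * 2 / R := by gcongr
      _ = 200 / 10 ^ 20 * (1 / (D : ℝ)) := by rw [hR']; field_simp; norm_num
      _ ≤ 200 / 10 ^ 20 * ε := by gcongr
      _ ≤ _ := by linarith only [hε0]
  have hbox : ((n ^ d : ℕ) : ℝ) ≤ β ^ L := by
    have h2 : (2 : ℝ) ≤ β ^ (100 * D) := two_le_gridRatio_pow hD1
    calc ((n ^ d : ℕ) : ℝ) ≤ 2 ^ (D * d) := by exact_mod_cast hm
      _ ≤ (β ^ (100 * D)) ^ (D * d) := by gcongr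
      _ = _ := by rw [← pow_mul]
  have hκτ : 2 * κ ≤ (1 / (T : ℝ)) ^ 2 := by
    exact two_mul_rate_le (by linarith only [hDR, hDr]) hT1
  have hJκ : 2 * n / κ < 2 ^ J := by
    have h1 : 2 * n / κ = ((n * (64 * R * T ^ 4) : ℕ) : ℝ) := by
      rw [hκ]
      push_cast
      field_simp
      norm_num
    have h2 : n * (64 * R * T ^ 4) < 2 ^ J := by
      calc n * (64 * R * T ^ 4) < 2 ^ D * 2 ^ (64 * R * T ^ 4) :=
            Nat.mul_lt_mul_of_le_of_lt hDn Nat.lt_two_pow_self (by positivity)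
        _ = 2 ^ (D + 64 * R * T ^ 4) := (pow_add _ _ _).symm
        _ ≤ 2 ^ J := Nat.pow_le_pow_right two_pos hJ
    rw [h1]
    exact_mod_cast h2
  -- The value of `M` is chosen to make the union bound at most `4 ^ (-K)`, as the fixed list of
  -- rows requires.
  have hfail : (J : ℝ) * ((L + 1 : ℕ) : ℝ) / (tol ^ 2 * M) ≤ 1 / 4 ^ K := by
    have hJr : (0 : ℝ) < J := by exact_mod_cast hJ0
    have e : tol ^ 2 * M = 4 ^ K * J * (100 * (d + 1) * D ^ 2) := by
      rw [htol, hM]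
      push_cast
      field_simp
    rw [e, div_le_div_iff₀ (by positivity) (by positivity)]
    push_cast
    calc (J : ℝ) * (L + 1) * 4 ^ K ≤ J * (100 * (d + 1) * D ^ 2) * 4 ^ K := by gcongr
      _ = _ := by ring
  -- The list length `2 ^ s` must exceed the binary logarithm of the number of inputs, so `s` itself
  -- need only be of order `D * d`.
  have hseed : (2 * n ^ d + 1) ^ n < 2 ^ 2 ^ s := by
    have h1 : 2 * n ^ d + 1 < 2 ^ (D * d + 2) := by
      rw [pow_add]
      have : 0 < 2 ^ (D * d) := by positivity
      linarith only [this, hm]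
    calc (2 * n ^ d + 1) ^ n < (2 ^ (D * d + 2)) ^ n := Nat.pow_lt_pow_left h1 (by omega)
      _ = 2 ^ ((D * d + 2) * n) := (pow_mul _ _ _).symm
      _ ≤ 2 ^ 2 ^ s := by
        refine Nat.pow_le_pow_right two_pos ?_
        calc (D * d + 2) * n ≤ 2 ^ (D * d + 2) * 2 ^ D :=
              Nat.mul_le_mul Nat.lt_two_pow_self.le hDn
          _ = 2 ^ (D * d + 2 + D) := (pow_add _ _ _).symm
          _ ≤ _ := Nat.pow_le_pow_right two_pos hsD
  obtain ⟨σ, hσ⟩ := exists_consistent_rows (L := L + 1) β htol0 hM0 hfail hseed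
  refine ⟨searchSketch β tol (L + 1) (n ^ d) k p σ, searchSketch_usesAtMostBits ?_,
    fun x hx => one_sub_le_probWithin _ hδ _ (fun ω hω => ?_) (hσ x hx)⟩
  · calc n * n ^ d ≤ 2 ^ D * 2 ^ (D * d) := Nat.mul_le_mul hDn hm
      _ = 2 ^ (D + D * d) := (pow_add _ _ _).symm
      _ < 2 ^ w := Nat.pow_lt_pow_right one_lt_two hwD
  · obtain ⟨y, hy, hcy, hest⟩ := searchSketch_estimate (p := p) (k := k) (σ := σ) ω hx hω
    have hbudget := error_budget (D := D) hDr (by linarith only [hDR, hDr])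
      (by linarith only [hDR, hDr]) hT' hκ htol
    have hβa : β * (1 / (200 * D)) ≤ β - 1 := by
      have : (1 : ℝ) / (200 * D) = 1 / (100 * D) / 2 := by field_simp; norm_num
      rw [this, hβ]
      nlinarith only [hu0, hu1]
    have hτ1 : 1 / (T : ℝ) ≤ 1 := by
      rw [div_le_one hT0]
      exact hT1
    rw [hest]
    exact abs_trimmedMoment_sub_le hp0 hp2 hk hβ1 (by positivity) hε0 hε1 hβ6 hηε
      (countDominated_of_consistent hM0 hβ1 (by positivity) hβa (by positivity) hτ1 hκ0 hκτ
        (by positivity) hJκ hbudget hω hcy)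
      (countDominated_of_consistent hM0 hβ1 (by positivity) hβa (by positivity) hτ1 hκ0 hκτ
        (by positivity) hJκ hbudget hcy hω)
      (fun i => le_trans (by exact_mod_cast topAbs_le x hx i) hbox)
      (fun i => le_trans (by exact_mod_cast topAbs_le y hy i) hbox)

theorem theorem4 (c : ℝ) :
    ∃ E : ℕ, ∀ (δ : ℝ) (d : ℕ), 0 < δ → ∃ C : ℝ,
      ∀ (n k : ℕ) (ε p : ℝ), 2 ≤ n → 2 * k ≤ n → 0 < ε → ε < 1 → 0 ≤ p → p ≤ 2 →
        ∃ A : LinearSketch n,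
          A.UsesAtMostBits (n ^ d) (C * (Real.log n / ε) ^ E) ∧
          ∀ x : Fin n → ℤ, (∀ i, |x i| ≤ ((n ^ d : ℕ) : ℤ)) →
            (1 ≤ k → (topAbs x k : ℝ) ^ 2 ≥
              (ε / Real.log n) ^ c * ((tailSq x k : ℝ) / (k : ℝ))) →
            1 - δ ≤ A.probWithin x (trimmedMoment x k p)
              (ε * (trimmedMoment x k p +
                (k : ℝ) * freqPow p (topAbs x ⌈(k : ℝ) - ε * (k : ℝ)⌉₊))) := by
  -- In powers of `D`: `R` has degree `3` and `T` degree `4`, so `J` has `3 + 16 = 19`, `M` has `19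
  -- + 2 + 2 * (6 + 16) = 65`, and the counter width has `1`. The total is `19 + 65 + 1 = 85`.
  refine ⟨85, fun δ d hδ => ?_⟩
  -- Fewer than a fraction `1 / K ≤ δ` of the seeds will be bad for any input.
  set K := ⌈1 / δ⌉₊
  have hK : 1 ≤ K * δ := by
    rw [← div_le_iff₀ hδ]
    exact Nat.le_ceil _
  obtain ⟨r, hr⟩ : ∃ r : ℕ, r = 10 ^ 20 * (d + 1) := ⟨_, rfl⟩
  let j := 1 + 64 * r ^ 5 * 200 ^ 4
  let B := (d + 4) + j * (4 ^ K * j * (100 * (d + 1)) * (128 * r ^ 6 * 200 ^ 4) ^ 2) * (d + 3)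
  refine ⟨B * 4 ^ 85, fun n k ε p hn hk hε0 hε1 hp0 hp2 => ?_⟩
  obtain ⟨D, hD1, hDε, hDn, hDΛ⟩ := exists_size_parameter hn hε0 hε1
  obtain ⟨A, ⟨w, hw1, hw2⟩, hA⟩ := exists_trimmedMoment_sketch (d := d) (R := r * D ^ 3) (J := j * D ^ 19) hn hk hε0
    hε1 hp0 hp2 hK hD1 hDε hDn (by rw [hr]) rfl
    (by
      have : D ≤ D ^ 19 := Nat.le_self_pow (by norm_num) D
      calc D + 64 * (r * D ^ 3) * (200 * D * (r * D ^ 3)) ^ 4 =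
            D + 64 * r ^ 5 * 200 ^ 4 * D ^ 19 := by ring
        _ ≤ D ^ 19 + 64 * r ^ 5 * 200 ^ 4 * D ^ 19 := by gcongr
        _ = j * D ^ 19 := by simp only [j]; ring) rfl rfl rfl
  refine ⟨A, ⟨w, hw1, hw2.trans ?_⟩, fun x hx _ => hA x hx⟩
  have hbits : (d + 4) * D + j * D ^ 19 * (4 ^ K * (j * D ^ 19) * (100 * (d + 1) * D ^ 2) *
      (128 * (r * D ^ 3) ^ 2 * (200 * D * (r * D ^ 3)) ^ 4) ^ 2) * ((d + 2) * D + 1) ≤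
      B * D ^ 85 := by
    have h1 : D ≤ D ^ 85 := Nat.le_self_pow (by norm_num) D
    calc _ ≤ (d + 4) * D ^ 85 + j * D ^ 19 * (4 ^ K * (j * D ^ 19) * (100 * (d + 1) * D ^ 2) *
          (128 * (r * D ^ 3) ^ 2 * (200 * D * (r * D ^ 3)) ^ 4) ^ 2) * ((d + 2) * D + D) := by
          gcongr
      _ = _ := by simp only [B]; ring
  calc _ ≤ ((B * D ^ 85 : ℕ) : ℝ) := by exact_mod_cast hbits
    _ = B * (D : ℝ) ^ 85 := by push_cast; ring
    _ ≤ B * (4 * (Real.log n / ε)) ^ 85 := by gcongr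
    _ = _ := by rw [mul_pow]; ring
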